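/- **Refined enumeration of quarter-turn symmetric domino tilings of the holey Aztec square.** Let $n\ge 1$. *Tilings.* Consider the square lattice tilted by $45^\circ$, with black cells centred at the points of $\mathbb Z^2$ and white cells centred at the points of $(\mathbb Z+\frac12)^2$; a black and a white cell are adjacent when their centres differ by $(\pm\frac12,\pm\frac12)$, and a domino is a pair of adjacent cells. The domain $\mathcal A_n$ consists of the white cells $(x,y)$ with $|x|,|y|<n$ except $(\pm\frac12,\pm\frac12)$, the black cells $(x,y)$ with $|x|,|y|<n$ except $(0,0)$, and the black cells $(a,n),(-n,a),(-a,-n),(n,-a)$ for $1\le a\le n-1$. We consider the domino tilings of $\mathcal A_n$ that are invariant under the rotation by $\pi/2$ around the origin. For such a tiling $T$, let $\ell_2(T)$ be the number of dominos made of a black cell $(a,n)$, $1\le a\le n-1$, and of its lower-left neighbour $(a-\frac12,n-\frac12)$ (the up-right dominos of the top row of the fundamental domain), and let $\ell_1(T)$ be $\ell_2(T)$ plus the number of dominos made of a white cell $(x,n-\frac12)$ with $x>0$ and of its lower-right neighbour $(x+\frac12,n-1)$. *Paths.* A restricted Schröder path is a lattice path with steps $(-1,0)$, $(0,1)$, $(-1,1)$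 whose last step is not $(0,1)$. A configuration of size $n$ is a set $\mathcal P$ of pairwise non-intersecting (vertex-disjoint) restricted Schröder paths whose starting points are the $(i,0)$, $i\in I$, and whose endpoints are the $(0,i+1)$, $i\in I$, for some (possibly empty) $I\subseteq\{1,\dots,n-1\}$. For a path $p$ ending at $(0,n)$, let $\ell_1(p)$ be the $x$ coordinate of its last point with $y\le n-1$ and $\ell_2(p)$ the $x$ coordinate of its first point with $y=n$; for the other paths $\ell_1(p)=\ell_2(p)=0$. Put $\ell_m(\mathcal P)=\sum_{p\in\mathcal P}\ell_m(p)$. For $m=1,2$, let $T^{(m)}_{4,k}(\mathcal A_n)$ be the number of configurations $\mathcal P$ of size $n$ with $\ell_m(\mathcal P)=k$, and $$T_4^{(m)}(\mathcal A_n;\tau)=\sum_{k=0}^{n-1}\tau^k\,T^{(m)}_{4,k}(\mathcal A_n).$$ **Theorem.** For $m=1,2$ and every $k\ge 0$, $T^{(m)}_{4,k}(\mathcal A_n)$ is the number of quarter-turn symmetric domino tilings $T$ of $\mathcal A_n$ with $\ell_m(T)=k$. Moreover, write $f|_{r^is^j}$ for the coefficient of $r^is^j$ in the power series expansion of $f$,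 and let $$G=\frac1{1-rs}+\frac{2r}{(1-r)(1-r-s-rs)},\qquad c_1(\tau)=2\tau,\qquad c_2(\tau)=1+\tau .$$ Then for every field $K$ and every $\tau\in K$ (in particular for an indeterminate $\tau$, with $K=\mathbb Q(\tau)$), and for $m=1,2$, $$T_4^{(m)}(\mathcal A_n;\tau)=\det_{0\le i,j\le n-1}\begin{pmatrix} G\big|_{r^is^j} & (j\le n-2)\\[2pt] \Big(\frac1{1-rs}+\frac{c_m(\tau)\,r}{(1-\tau r)(1-r-s-rs)}\Big)\Big|_{r^is^j} & (j=n-1)\end{pmatrix}$$ $$=\det_{0\le i,j\le n-1}\left(\Big(G+s^{n-1}\,r\,\Big\{\frac{c_m(\tau)}{1-\tau r}-\frac2{1-r}\Big\}\frac{(1+r)^{n-1}}{(1-r)^n}\Big)\Big|_{r^is^j}\right).$$ -/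

import Mathlib

namespace HoleyAztec

noncomputable section

/-! ### Restricted Schröder paths -/

/-- Left step `(-1,0)`. -/
def IsLeft (a b : ℕ × ℕ) : Prop := a.1 = b.1 + 1 ∧ b.2 = a.2

/-- Up step `(0,1)`. -/
def IsUp (a b : ℕ × ℕ) : Prop := b.1 = a.1 ∧ b.2 = a.2 + 1

/-- Diagonal step `(-1,1)`. -/
def IsDiag (a b : ℕ × ℕ) : Prop := a.1 = b.1 + 1 ∧ b.2 = a.2 + 1

/-- `p` is the list of successive points of a restricted Schröder path from `(i,0)` to `(0,j)`:
all steps are left, up or diagonal, and the last step is not up. -/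
structure IsRestrictedPath (i j : ℕ) (p : List (ℕ × ℕ)) : Prop where
  start : p.head? = some (i, 0)
  finish : p.getLast? = some (0, j)
  steps : p.IsChain (fun a b => IsLeft a b ∨ IsUp a b ∨ IsDiag a b)
  last : ∀ q a b, p = q ++ [a, b] → ¬ IsUp a b

/-- `P` is a set of pairwise non-intersecting restricted Schröder paths whose set of starting
points is `{(i,0) | i ∈ I}` and whose set of endpoints is `{(0,i+1) | i ∈ I}`,
for some `I ⊆ {1,…,n-1}`. -/
def IsConfig (n : ℕ) (P : Finset (List (ℕ × ℕ))) : Prop :=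
  ∃ I : Finset ℕ, I ⊆ Finset.Ico 1 n ∧
    (∀ p ∈ P, ∃ i ∈ I, ∃ j ∈ I, IsRestrictedPath i (j + 1) p) ∧
    (∀ i ∈ I, ∃ p ∈ P, p.head? = some (i, 0)) ∧
    (∀ j ∈ I, ∃ p ∈ P, p.getLast? = some (0, j + 1)) ∧
    (∀ p ∈ P, ∀ q ∈ P, p ≠ q → p.Disjoint q)

/-- For a path ending at `(0,n)`: the `x` coordinate of its last point with `y ≤ n - 1`;
zero for the other paths. -/
def ell₁ (n : ℕ) (p : List (ℕ × ℕ)) : ℕ :=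
  if p.getLast? = some (0, n) then
    ((p.filter (fun v => v.2 < n)).getLast?).elim 0 Prod.fst
  else 0

/-- For a path ending at `(0,n)`: the `x` coordinate of its first point with `y = n`;
zero for the other paths. -/
def ell₂ (n : ℕ) (p : List (ℕ × ℕ)) : ℕ :=
  if p.getLast? = some (0, n) then
    (p.find? (fun v => v.2 = n)).elim 0 Prod.fst
  else 0

/-- The refined number of type 1: configurations `P` with `∑ p ∈ P, ell₁ n p = k`. -/
def refined₁ (n k : ℕ) : ℕ :=
  {P : Finset (List (ℕ × ℕ)) | IsConfig n P ∧ ∑ p ∈ P, ell₁ n p = k}.ncard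

/-- The refined number of type 2: configurations `P` with `∑ p ∈ P, ell₂ n p = k`. -/
def refined₂ (n k : ℕ) : ℕ :=
  {P : Finset (List (ℕ × ℕ)) | IsConfig n P ∧ ∑ p ∈ P, ell₂ n p = k}.ncard

/-- The refined partition function of type 1. -/
def partition₁ {K : Type*} [Field K] (n : ℕ) (τ : K) : K :=
  ∑ k ∈ Finset.range n, τ ^ k * (refined₁ n k : K)

/-- The refined partition function of type 2. -/
def partition₂ {K : Type*} [Field K] (n : ℕ) (τ : K) : K :=
  ∑ k ∈ Finset.range n, τ ^ k * (refined₂ n k : K)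

/-! ### Quarter-turn symmetric domino tilings

The underlying square lattice is tilted by 45 degrees. A cell is recorded by twice the
coordinates of its centre, the origin being the centre of the cross, and the unit of length being
the diagonal of a cell. Black cells have two even coordinates, white cells two odd ones; two cells
share an edge iff both of their coordinates differ by one. -/

/-- The quasi-square domain of size `2n × 2n`: the `2n × 2n` white cells and the
`(2n-1) × (2n-1)` black cells between them, without the central cross (the black cell at the origin
and its four white neighbours), and with `n - 1` further black cells along one half of each side. -/
def domain (n : ℕ) : Set (ℤ × ℤ) :=
  {c | (Odd c.1 ∧ Odd c.2 ∧ |c.1| < 2 * n ∧ |c.2| < 2 * n ∧ ¬ (|c.1| = 1 ∧ |c.2| = 1)) ∨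
    (Even c.1 ∧ Even c.2 ∧ |c.1| < 2 * n ∧ |c.2| < 2 * n ∧ c ≠ (0, 0)) ∨
    (Even c.1 ∧ Even c.2 ∧
      ((0 < c.1 ∧ c.1 < 2 * n ∧ c.2 = 2 * n) ∨
        (c.1 = -(2 * n) ∧ 0 < c.2 ∧ c.2 < 2 * n) ∨
        (-(2 * n) < c.1 ∧ c.1 < 0 ∧ c.2 = -(2 * n)) ∨
        (c.1 = 2 * n ∧ -(2 * n) < c.2 ∧ c.2 < 0)))}

/-- A domino is a pair `(b, w)` of a black cell `b` and a white cell `w` that share an edge. -/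
def IsDomino (d : (ℤ × ℤ) × (ℤ × ℤ)) : Prop :=
  Even d.1.1 ∧ Even d.1.2 ∧ |d.2.1 - d.1.1| = 1 ∧ |d.2.2 - d.1.2| = 1

/-- The rotation by a quarter-turn around the centre of the cross. -/
def rot (c : ℤ × ℤ) : ℤ × ℤ := (-c.2, c.1)

/-- `T` is a domino tiling of the domain that is invariant under quarter-turns. -/
structure IsSymmetricTiling (n : ℕ) (T : Finset ((ℤ × ℤ) × (ℤ × ℤ))) : Prop where
  domino : ∀ d ∈ T, IsDomino d ∧ d.1 ∈ domain n ∧ d.2 ∈ domain n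
  cover : ∀ c ∈ domain n, ∃! d, d ∈ T ∧ (d.1 = c ∨ d.2 = c)
  symm : ∀ d ∈ T, (rot d.1, rot d.2) ∈ T

/-- The dominos made of one of the black cells `(2a,2n)`, `0 < a < n`, that form the top row, and of
its lower left white neighbour. They are the up-right dominos of the top row of the fundamental
domain (the left steps at height `n`). -/
def topUpRight (n : ℕ) (T : Finset ((ℤ × ℤ) × (ℤ × ℤ))) : Finset ((ℤ × ℤ) × (ℤ × ℤ)) :=
  T.filter (fun d => d.1.2 = 2 * n ∧ d.2 = (d.1.1 - 1, d.1.2 - 1))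

/-- The dominos made of a white cell of the top row of white cells, right of the vertical axis, and
of its lower right black neighbour (a diagonal step from height `n - 1` to height `n`). -/
def topDiag (n : ℕ) (T : Finset ((ℤ × ℤ) × (ℤ × ℤ))) : Finset ((ℤ × ℤ) × (ℤ × ℤ)) :=
  T.filter (fun d => d.2.2 = 2 * n - 1 ∧ 0 < d.2.1 ∧ d.1 = (d.2.1 + 1, d.2.2 - 1))

/-- The number of quarter-turn symmetric tilings of type 1 top-row statistic `k`. -/
def tilingRefined₁ (n k : ℕ) : ℕ :=
  {T | IsSymmetricTiling n T ∧ (topUpRight n T).card + (topDiag n T).card = k}.ncard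

/-- The number of quarter-turn symmetric tilings with `k` up-right dominos in the top row of the
fundamental domain. -/
def tilingRefined₂ (n k : ℕ) : ℕ :=
  {T | IsSymmetricTiling n T ∧ (topUpRight n T).card = k}.ncard

/-! ### Generating functions in `r` and `s` -/

section

variable {K : Type*} [Field K]

/-- The variable `r`. -/
def r : MvPowerSeries (Fin 2) K := MvPowerSeries.X 0

/-- The variable `s`. -/
def s : MvPowerSeries (Fin 2) K := MvPowerSeries.X 1

/-- The coefficient of `r ^ i * s ^ j`. -/
def coeffRS (i j : ℕ) (f : MvPowerSeries (Fin 2) K) : K :=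
  MvPowerSeries.coeff (Finsupp.single 0 i + Finsupp.single 1 j) f

/-- A constant as a power series. -/
def const (a : K) : MvPowerSeries (Fin 2) K := MvPowerSeries.C a

/-- `1/(1-rs) + 2r/((1-r)(1-r-s-rs))`. -/
def gen : MvPowerSeries (Fin 2) K :=
  (1 - r * s)⁻¹ + 2 * r * ((1 - r) * (1 - r - s - r * s))⁻¹

/-- `1/(1-rs) + 2τr/((1-τr)(1-r-s-rs))`. -/
def genLast₁ (τ : K) : MvPowerSeries (Fin 2) K :=
  (1 - r * s)⁻¹ + 2 * const τ * r * ((1 - const τ * r) * (1 - r - s - r * s))⁻¹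

/-- `1/(1-rs) + (1+τ)r/((1-τr)(1-r-s-rs))`. -/
def genLast₂ (τ : K) : MvPowerSeries (Fin 2) K :=
  (1 - r * s)⁻¹ + (1 + const τ) * r * ((1 - const τ * r) * (1 - r - s - r * s))⁻¹

/-- `gen + s^(n-1) r {2τ/(1-τr) - 2/(1-r)} (1+r)^(n-1)/(1-r)^n`. -/
def genCompact₁ (n : ℕ) (τ : K) : MvPowerSeries (Fin 2) K :=
  gen + s ^ (n - 1) * r * (2 * const τ * (1 - const τ * r)⁻¹ - 2 * (1 - r)⁻¹) *
    ((1 + r) ^ (n - 1) * ((1 - r) ^ n)⁻¹)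

/-- `gen + s^(n-1) r {(1+τ)/(1-τr) - 2/(1-r)} (1+r)^(n-1)/(1-r)^n`. -/
def genCompact₂ (n : ℕ) (τ : K) : MvPowerSeries (Fin 2) K :=
  gen + s ^ (n - 1) * r * ((1 + const τ) * (1 - const τ * r)⁻¹ - 2 * (1 - r)⁻¹) *
    ((1 + r) ^ (n - 1) * ((1 - r) ^ n)⁻¹)

/-- The `n × n` matrix with the coefficients of `r^i s^j`, `0 ≤ i, j ≤ n-1`, of `f` in the columns
`j ≤ n-2`, and of `g` in the column `j = n-1`. -/
def lastColumnMatrix (n : ℕ) (f g : MvPowerSeries (Fin 2) K) : Matrix (Fin n) (Fin n) K :=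
  Matrix.of fun i j => if (j : ℕ) + 1 < n then coeffRS i j f else coeffRS i j g

/-- The `n × n` truncation: the coefficients of `r^i s^j`, `0 ≤ i, j ≤ n-1`, of `f`. -/
def truncMatrix (n : ℕ) (f : MvPowerSeries (Fin 2) K) : Matrix (Fin n) (Fin n) K :=
  Matrix.of fun i j => coeffRS i j f

end

end

end HoleyAztec

namespace HoleyAztec

/-! ### Coefficient extraction in `r` and `s`, and the generating function of weighted paths. -/

section Coefficients

variable {K : Type*} [Field K]

/-! Everything is compared with permutations of one finite set. Take the lattice points `(x, y)`
with `1 ≤ x < n`, `0 ≤ y ≤ n`, and glue each axis point `(0, b + 1)` to the starting point `(b, 0)`.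
The steps become the edges of a graph on a cone; a cover is a permutation that fixes each vertex or
moves it along an edge. Cutting the nontrivial cycles of a cover at the glued edges gives disjoint
restricted paths, and every configuration arises once, because its starts and its ends have the same
index set (`IsConfig.exists_associated`, `IsCover.exists_associated`). A quarter-turn symmetric
tiling matches orbits of black cells with orbits of white cells. Both kinds of orbits are indexed by
the vertices, the four neighbours of a black cell encode "fixed" and the three steps, and the
rotation realises the gluing, so these tilings are the covers too (`exists_tilingOf_eq`).

For the determinants, let left steps at height `n` weigh `τ`, diagonal steps to height `n` weigh
`β`, and other steps weigh 1. Let `A`, `E`, `S`, `W` be the step, exit, start and path matrices.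
Since `(1 - A) W = E`, the cone matrix `1 - A + E S` equals `(1 - A)(1 + W S)`. The step graph is
acyclic, so `det (1 - A) = 1`, and `det (1 + W S) = det (1 + S W)` is the determinant of path
generating functions (`det_coneMatrix`).

The Leibniz expansion of the same determinant is a signed sum over covers. Disjoint paths cannot
cross, so the path from `(i, 0)` ends at `(0, i + 1)` and each nontrivial cycle uses exactly one
glued edge. A cycle of length `L` then has sign `(-1)^(L-1)`, cancelled by the `-1` on each of its
`L - 1` unglued edges (`sign_mul_prod_edgeSign`). Hence the determinant is the sum over covers of
`τ^left β^diag`; `β = τ` gives the first statistic and `β = 1` the second.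

The last column has this form because a path to `(0, n)` reaches some `(t, n - 1)` with `t ≥ 1`,
then goes up and makes `t` left steps, or goes diagonally and makes `t - 1` of them. The total is
`(τ + β) τ^(t-1)`, whence the factor `(τ + β) r / (1 - τ r)`. The compact form follows by extracting
the coefficient of `s^(n-1)`. -/

lemma coeffRS_add (i j : ℕ) (f g : MvPowerSeries (Fin 2) K) :
    coeffRS i j (f + g) = coeffRS i j f + coeffRS i j g := by
  simp [coeffRS]

lemma coeffRS_sub (i j : ℕ) (f g : MvPowerSeries (Fin 2) K) :
    coeffRS i j (f - g) = coeffRS i j f - coeffRS i j g := by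
  simp [coeffRS]

lemma coeffRS_const_mul (i j : ℕ) (a : K) (f : MvPowerSeries (Fin 2) K) :
    coeffRS i j (const a * f) = a * coeffRS i j f := by
  simp [coeffRS, const]

lemma coeffRS_succ_r_mul (i j : ℕ) (f : MvPowerSeries (Fin 2) K) :
    coeffRS (i + 1) j (r * f) = coeffRS i j f := by
  have h : (Finsupp.single (0 : Fin 2) (i + 1) + Finsupp.single 1 j : Fin 2 →₀ ℕ)
      = Finsupp.single 0 1 + (Finsupp.single 0 i + Finsupp.single 1 j) := by
    rw [Finsupp.single_add]; abel
  rw [coeffRS, h, r, MvPowerSeries.X, MvPowerSeries.coeff_add_monomial_mul, one_mul, coeffRS]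

lemma coeffRS_zero_r_mul (j : ℕ) (f : MvPowerSeries (Fin 2) K) :
    coeffRS 0 j (r * f) = 0 := by
  classical
  rw [coeffRS, r, MvPowerSeries.X, MvPowerSeries.coeff_monomial_mul, if_neg]
  intro h
  have := h 0
  simp at this

lemma coeffRS_succ_s_mul (i j : ℕ) (f : MvPowerSeries (Fin 2) K) :
    coeffRS i (j + 1) (s * f) = coeffRS i j f := by
  have h : (Finsupp.single (0 : Fin 2) i + Finsupp.single 1 (j + 1) : Fin 2 →₀ ℕ)
      = Finsupp.single 1 1 + (Finsupp.single 0 i + Finsupp.single 1 j) := by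
    rw [Finsupp.single_add]; abel
  rw [coeffRS, h, s, MvPowerSeries.X, MvPowerSeries.coeff_add_monomial_mul, one_mul, coeffRS]

lemma coeffRS_zero_s_mul (i : ℕ) (f : MvPowerSeries (Fin 2) K) :
    coeffRS i 0 (s * f) = 0 := by
  classical
  rw [coeffRS, s, MvPowerSeries.X, MvPowerSeries.coeff_monomial_mul, if_neg]
  intro h
  have := h 1
  simp at this

lemma coeffRS_one (i j : ℕ) :
    coeffRS i j (1 : MvPowerSeries (Fin 2) K) = if i = 0 ∧ j = 0 then 1 else 0 := by
  classical
  rw [coeffRS, MvPowerSeries.coeff_one]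
  congr 1
  simp [add_eq_zero, Finsupp.single_eq_zero]

lemma coeffRS_s_pow_mul (i k : ℕ) (j : ℕ) (f : MvPowerSeries (Fin 2) K) :
    coeffRS i j (s ^ k * f) = if k ≤ j then coeffRS i (j - k) f else 0 := by
  induction k generalizing j with
  | zero => simp
  | succ k ih =>
    rw [pow_succ', mul_assoc]
    cases j with
    | zero => simp [coeffRS_zero_s_mul]
    | succ j => rw [coeffRS_succ_s_mul, ih]; simp

/-- The series does not involve `s`. -/
def FreeOfS (f : MvPowerSeries (Fin 2) K) : Prop := ∀ i j, coeffRS i (j + 1) f = 0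

lemma constantCoeff_one_sub (τ : K) :
    MvPowerSeries.constantCoeff (1 - const τ * r : MvPowerSeries (Fin 2) K) ≠ 0 := by
  simp [r, const]

lemma constantCoeff_one_sub_r :
    MvPowerSeries.constantCoeff (1 - r : MvPowerSeries (Fin 2) K) ≠ 0 := by
  simp [r]

lemma constantCoeff_delannoy :
    MvPowerSeries.constantCoeff (1 - r - s - r * s : MvPowerSeries (Fin 2) K) ≠ 0 := by
  simp [r, s]

lemma constantCoeff_one_sub_rs :
    MvPowerSeries.constantCoeff (1 - r * s : MvPowerSeries (Fin 2) K) ≠ 0 := by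
  simp [r, s]

lemma const_one : (const 1 : MvPowerSeries (Fin 2) K) = 1 := by
  simp [const]

lemma freeOfS_one : FreeOfS (1 : MvPowerSeries (Fin 2) K) := by
  intro i j; simp [coeffRS_one]

lemma FreeOfS.r_mul {f : MvPowerSeries (Fin 2) K} (hf : FreeOfS f) : FreeOfS (r * f) := by
  intro i j
  cases i with
  | zero => exact coeffRS_zero_r_mul _ _
  | succ i => rw [coeffRS_succ_r_mul]; exact hf i j

lemma FreeOfS.const_mul {f : MvPowerSeries (Fin 2) K} (hf : FreeOfS f) (a : K) :
    FreeOfS (const a * f) := by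
  intro i j; rw [coeffRS_const_mul, hf, mul_zero]

lemma FreeOfS.add {f g : MvPowerSeries (Fin 2) K} (hf : FreeOfS f) (hg : FreeOfS g) :
    FreeOfS (f + g) := by
  intro i j; rw [coeffRS_add, hf, hg, add_zero]

lemma FreeOfS.sub {f g : MvPowerSeries (Fin 2) K} (hf : FreeOfS f) (hg : FreeOfS g) :
    FreeOfS (f - g) := by
  intro i j; rw [coeffRS_sub, hf, hg, sub_zero]

lemma freeOfS_of_mul {f g : MvPowerSeries (Fin 2) K} {τ : K} (hf : FreeOfS f)
    (h : (1 - const τ * r) * g = f) : FreeOfS g := by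
  intro i j
  have hg : g = f + const τ * (r * g) := by rw [← h]; ring
  induction i with
  | zero =>
    rw [hg, coeffRS_add, coeffRS_const_mul, coeffRS_zero_r_mul, hf]; simp
  | succ i ih => rw [hg, coeffRS_add, coeffRS_const_mul, coeffRS_succ_r_mul, hf, ih]; simp

lemma FreeOfS.mul_inv {f : MvPowerSeries (Fin 2) K} (hf : FreeOfS f) (τ : K) :
    FreeOfS (f * (1 - const τ * r)⁻¹) := by
  refine freeOfS_of_mul (τ := τ) hf ?_
  rw [mul_comm, mul_assoc, MvPowerSeries.inv_mul_cancel _ (constantCoeff_one_sub τ), mul_one]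

lemma FreeOfS.mul_inv_one {f : MvPowerSeries (Fin 2) K} (hf : FreeOfS f) :
    FreeOfS (f * (1 - r)⁻¹) := by
  have := hf.mul_inv 1
  rwa [const_one, one_mul] at this

/-- The coefficients of `s ^ m` in `f / (1 - r - s - r s)`, for `f` a series in `r`. -/
lemma FreeOfS.coeffRS_mul_delannoy {f : MvPowerSeries (Fin 2) K} (hf : FreeOfS f) (i m : ℕ) :
    coeffRS i m (f * (1 - r - s - r * s)⁻¹)
      = coeffRS i 0 (f * ((1 + r) ^ m * ((1 - r) ^ (m + 1))⁻¹)) := by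
  have hD := MvPowerSeries.mul_inv_cancel (1 - r - s - r * s : MvPowerSeries (Fin 2) K)
    constantCoeff_delannoy
  have hR := MvPowerSeries.mul_inv_cancel (1 - r : MvPowerSeries (Fin 2) K)
    constantCoeff_one_sub_r
  have hpow : ∀ k : ℕ, ((1 - r : MvPowerSeries (Fin 2) K) ^ k)⁻¹ = ((1 - r)⁻¹) ^ k := by
    intro k
    rw [MvPowerSeries.inv_eq_iff_mul_eq_one, ← mul_pow, mul_comm, hR, one_pow]
    rw [map_pow]
    exact pow_ne_zero _ constantCoeff_one_sub_r
  -- As `1 - r - s - rs = (1 - r) - s(1 + r)`, removing one power of `s` multiplies the numerator by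
  -- `(1 + r)/(1 - r)`; the induction on `m` iterates this.
  have hfac : ∀ g : MvPowerSeries (Fin 2) K, g * (1 - r - s - r * s)⁻¹
      = g * (1 - r)⁻¹ + s * ((g * (1 - r)⁻¹ + r * (g * (1 - r)⁻¹)) * (1 - r - s - r * s)⁻¹) := by
    intro g
    have : (1 - r - s - r * s : MvPowerSeries (Fin 2) K)⁻¹
        = (1 - r)⁻¹ + s * (1 + r) * (1 - r)⁻¹ * (1 - r - s - r * s)⁻¹ := by
      linear_combination (-(1 - r - s - r * s : MvPowerSeries (Fin 2) K)⁻¹) * hR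
        + (1 - r)⁻¹ * hD
    conv_lhs => rw [this]
    ring
  rw [hpow]
  induction m generalizing f with
  | zero =>
    rw [hfac, coeffRS_add, coeffRS_zero_s_mul]
    simp
  | succ m ih =>
    rw [hfac, coeffRS_add, coeffRS_succ_s_mul, hf.mul_inv_one, zero_add,
      ih (hf.mul_inv_one.add hf.mul_inv_one.r_mul)]
    congr 1
    ring

/-- The series `1/(1-rs) + c r/((1-τr)(1-r-s-rs))`. -/
noncomputable def genColumn (τ c : K) : MvPowerSeries (Fin 2) K :=
  (1 - r * s)⁻¹ + const c * r * ((1 - const τ * r) * (1 - r - s - r * s))⁻¹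

lemma const_add (a b : K) : (const (a + b) : MvPowerSeries (Fin 2) K) = const a + const b := by
  simp [const]

lemma const_mul (a b : K) : (const (a * b) : MvPowerSeries (Fin 2) K) = const a * const b := by
  simp [const]

lemma const_two : (const 2 : MvPowerSeries (Fin 2) K) = 2 := by
  rw [const, map_ofNat]

lemma gen_eq_genColumn : (gen : MvPowerSeries (Fin 2) K) = genColumn 1 2 := by
  rw [gen, genColumn, const_two, const_one, one_mul]

lemma genLast₁_eq_genColumn (τ : K) : genLast₁ τ = genColumn τ (τ + τ) := by
  rw [genLast₁, genColumn, ← two_mul, const_mul, const_two]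

lemma genLast₂_eq_genColumn (τ : K) : genLast₂ τ = genColumn τ (τ + 1) := by
  rw [genLast₂, genColumn, const_add, const_one, add_comm 1]

lemma coeffRS_inv_one_sub_rs (i j : ℕ) :
    coeffRS i j ((1 - r * s : MvPowerSeries (Fin 2) K)⁻¹) = if i = j then 1 else 0 := by
  have h := MvPowerSeries.mul_inv_cancel (1 - r * s : MvPowerSeries (Fin 2) K)
    constantCoeff_one_sub_rs
  set f := (1 - r * s : MvPowerSeries (Fin 2) K)⁻¹
  have hf : f = 1 + r * (s * f) := by linear_combination h
  induction i generalizing j with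
  | zero =>
    rw [hf, coeffRS_add, coeffRS_zero_r_mul, coeffRS_one]
    simp [eq_comm]
  | succ i ih =>
    rw [hf, coeffRS_add, coeffRS_succ_r_mul, coeffRS_one]
    cases j with
    | zero => simp [coeffRS_zero_s_mul]
    | succ j => rw [coeffRS_succ_s_mul, ih]; simp

/-- The weighted number of paths from `(x, 0)` that end by entering the axis at height `k + 1`. -/
noncomputable def pathCoeff (τ c : K) (x k : ℕ) : K :=
  coeffRS x k (const c * r * ((1 - const τ * r) * (1 - r - s - r * s))⁻¹)

lemma coeffRS_genColumn (τ c : K) (i j : ℕ) :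
    coeffRS i j (genColumn τ c) = (if i = j then 1 else 0) + pathCoeff τ c i j := by
  rw [genColumn, coeffRS_add, coeffRS_inv_one_sub_rs, pathCoeff]

lemma pathCoeff_series_eq (τ c : K) :
    (const c * r * ((1 - const τ * r) * (1 - r - s - r * s))⁻¹ : MvPowerSeries (Fin 2) K)
      = const c * (r * (1 - const τ * r)⁻¹) * (1 - r - s - r * s)⁻¹ := by
  rw [MvPowerSeries.mul_inv_rev]; ring

lemma pathCoeff_zero_left (τ c : K) (k : ℕ) : pathCoeff τ c 0 k = 0 := by
  rw [pathCoeff, mul_assoc, coeffRS_const_mul, coeffRS_zero_r_mul, mul_zero]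

lemma coeffRS_geom (τ : K) (x : ℕ) :
    coeffRS x 0 ((1 - const τ * r : MvPowerSeries (Fin 2) K)⁻¹) = τ ^ x := by
  have h := MvPowerSeries.mul_inv_cancel (1 - const τ * r : MvPowerSeries (Fin 2) K)
    (constantCoeff_one_sub τ)
  set f := (1 - const τ * r : MvPowerSeries (Fin 2) K)⁻¹
  have hf : f = 1 + const τ * (r * f) := by linear_combination h
  induction x with
  | zero =>
    rw [hf, coeffRS_add, coeffRS_const_mul, coeffRS_zero_r_mul, coeffRS_one]
    simp
  | succ i ih =>
    rw [hf, coeffRS_add, coeffRS_const_mul, coeffRS_succ_r_mul, coeffRS_one, ih]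
    simp [pow_succ']

/-- A series `F/D` with `D = 1 - r - s - rs` satisfies `F/D = F + (r + s + rs) F/D`. The terms in
`r`, `s`, `rs` are a first step left, up, diagonal; `F`, which is free of `s`, is the boundary
value. -/
lemma pathCoeff_series_rec (τ c : K) :
    (const c * (r * (1 - const τ * r)⁻¹) * (1 - r - s - r * s)⁻¹ : MvPowerSeries (Fin 2) K)
      = const c * (r * (1 - const τ * r)⁻¹)
        + (r * (const c * (r * (1 - const τ * r)⁻¹) * (1 - r - s - r * s)⁻¹)
        + s * (const c * (r * (1 - const τ * r)⁻¹) * (1 - r - s - r * s)⁻¹)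
        + r * (s * (const c * (r * (1 - const τ * r)⁻¹) * (1 - r - s - r * s)⁻¹))) := by
  have hD := MvPowerSeries.mul_inv_cancel (1 - r - s - r * s : MvPowerSeries (Fin 2) K)
    constantCoeff_delannoy
  linear_combination (const c * (r * (1 - const τ * r)⁻¹)) * hD

/-- For `c = τ + β`, the term `c τ^x` collects an up step followed by `x + 1` left steps and a
diagonal step followed by `x` left steps. -/
lemma pathCoeff_succ_zero (τ c : K) (x : ℕ) :
    pathCoeff τ c (x + 1) 0 = pathCoeff τ c x 0 + c * τ ^ x := by
  rw [pathCoeff, pathCoeff_series_eq, pathCoeff_series_rec, pathCoeff, pathCoeff_series_eq]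
  simp only [coeffRS_add, coeffRS_succ_r_mul, coeffRS_zero_s_mul, coeffRS_const_mul, coeffRS_geom]
  ring

lemma pathCoeff_succ_succ (τ c : K) (x k : ℕ) :
    pathCoeff τ c (x + 1) (k + 1)
      = pathCoeff τ c x (k + 1) + pathCoeff τ c (x + 1) k + pathCoeff τ c x k := by
  have hfree : FreeOfS (r * (1 - const τ * r)⁻¹ : MvPowerSeries (Fin 2) K) := by
    have := (freeOfS_one (K := K)).mul_inv τ
    rw [one_mul] at this
    exact this.r_mul
  have h := congrArg (coeffRS (x + 1) (k + 1)) (pathCoeff_series_rec τ c)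
  rw [coeffRS_add, coeffRS_const_mul, hfree] at h
  simp only [coeffRS_add, coeffRS_succ_r_mul, coeffRS_succ_s_mul] at h
  simp only [pathCoeff, pathCoeff_series_eq]
  rw [h]
  ring

/-- Only the last column of the truncation differs from that of `gen`. -/
lemma truncMatrix_gen_add (n : ℕ) (hn : 1 ≤ n) (τ c : K) :
    truncMatrix n (gen + s ^ (n - 1) * r * (const c * (1 - const τ * r)⁻¹ - 2 * (1 - r)⁻¹) *
      ((1 + r) ^ (n - 1) * ((1 - r) ^ n)⁻¹)) = lastColumnMatrix n gen (genColumn τ c) := by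
  obtain ⟨m, rfl⟩ : ∃ m, n = m + 1 := ⟨n - 1, by omega⟩
  have h1 : FreeOfS (r * (1 - const τ * r)⁻¹ : MvPowerSeries (Fin 2) K) := by
    have := (freeOfS_one (K := K)).mul_inv τ
    rw [one_mul] at this
    exact this.r_mul
  have h2 : FreeOfS (r * (1 - const 1 * r)⁻¹ : MvPowerSeries (Fin 2) K) := by
    have := (freeOfS_one (K := K)).mul_inv 1
    rw [one_mul] at this
    exact this.r_mul
  have h3 := (h1.const_mul c).sub (h2.const_mul 2)
  ext i j
  simp only [truncMatrix, lastColumnMatrix, Matrix.of_apply, Nat.add_sub_cancel, coeffRS_add,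
    mul_assoc, coeffRS_s_pow_mul]
  have hj := j.2
  split_ifs with h h' h'
  · omega
  · have hjm : (j : ℕ) = m := by omega
    -- In the last column the correction is the coefficient of `s^m` in the difference of the two
    -- path series.
    have h4 := h3.coeffRS_mul_delannoy i m
    rw [hjm, Nat.sub_self, gen_eq_genColumn, genColumn, genColumn, coeffRS_add, coeffRS_add,
      pathCoeff_series_eq, pathCoeff_series_eq]
    rw [sub_mul, coeffRS_sub, sub_eq_iff_eq_add] at h4
    rw [h4, const_one, const_two, one_mul]
    have h5 : r * ((const c * (1 - const τ * r)⁻¹ - 2 * (1 - r)⁻¹) *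
          ((1 + r) ^ m * ((1 - r) ^ (m + 1))⁻¹)) =
        (const c * (r * (1 - const τ * r)⁻¹) - 2 * (r * (1 - r)⁻¹)) *
          ((1 + r) ^ m * ((1 - r) ^ (m + 1))⁻¹ : MvPowerSeries (Fin 2) K) := by ring
    rw [h5]
    ring
  · rw [add_zero]
  · omega

end Coefficients

open Equiv

/-! ### Covers of the cone graph -/

/-- A left, up or diagonal step. -/
def Step (a b : ℕ × ℕ) : Prop := IsLeft a b ∨ IsUp a b ∨ IsDiag a b

instance (a b : ℕ × ℕ) : Decidable (Step a b) := by
  unfold Step IsLeft IsUp IsDiag; infer_instance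

lemma step_iff {a b : ℕ × ℕ} : Step a b ↔
    (a.1 = b.1 + 1 ∧ b.2 = a.2) ∨ (b.1 = a.1 ∧ b.2 = a.2 + 1) ∨ (a.1 = b.1 + 1 ∧ b.2 = a.2 + 1) :=
  Iff.rfl

/-- The vertices: the points off the vertical axis. A point `(0, b + 1)` of the axis is identified
with the starting point `(b, 0)`. -/
abbrev Vertex (n : ℕ) : Type := ↥(Finset.Ico 1 n ×ˢ Finset.range (n + 1))

lemma Vertex.bounds {n : ℕ} (v : Vertex n) : 1 ≤ v.1.1 ∧ v.1.1 < n ∧ v.1.2 ≤ n := by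
  have := v.2
  simp only [Finset.mem_product, Finset.mem_Ico, Finset.mem_range] at this
  omega

lemma mem_vertex {n : ℕ} {a : ℕ × ℕ} (h1 : 1 ≤ a.1) (h2 : a.1 < n) (h3 : a.2 ≤ n) :
    a ∈ Finset.Ico 1 n ×ˢ Finset.range (n + 1) := by
  simp only [Finset.mem_product, Finset.mem_Ico, Finset.mem_range]
  omega

/-- The point of the plane that is reached from `v` by an edge to the vertex `u`. -/
def unglue (v u : ℕ × ℕ) : ℕ × ℕ := if u.2 = 0 ∧ 1 ≤ v.2 then (0, u.1 + 1) else u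

/-- A permutation of the vertices that fixes each vertex or moves it along an edge. -/
def IsCover (n : ℕ) (σ : Perm (Vertex n)) : Prop :=
  ∀ v, σ v = v ∨ Step v.1 (unglue v.1 (σ v).1)

instance (n : ℕ) (σ : Perm (Vertex n)) : Decidable (IsCover n σ) := by
  unfold IsCover; infer_instance

/-- Being fixed and following an edge are exclusive, so the two alternatives in a cover never
overlap. -/
lemma not_step_unglue_self (v : ℕ × ℕ) : ¬ Step v (unglue v v) := by
  rw [step_iff, unglue]
  split_ifs
  · dsimp only; omega
  · omega

/-! ### The cone matrix and two evaluations of its determinant. -/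

section Determinant

variable {K : Type*} [Field K]

/-- The weight of a step: `τ` for the left steps at height `n`, `β` for the diagonal steps to height
`n`, and one for the other steps. -/
def weight (n : ℕ) (τ β : K) (a b : ℕ × ℕ) : K :=
  if b.2 = n then (if a.2 = n then τ else if b.1 = a.1 then 1 else β) else 1

/-- The weighted adjacency matrix of the steps between vertices. -/
def stepMatrix (n : ℕ) (τ β : K) : Matrix (Vertex n) (Vertex n) K :=
  Matrix.of fun v u => if Step v.1 u.1 then weight n τ β v.1 u.1 else 0

/-- The weighted adjacency matrix of the steps from vertices to the axis. -/
def exitMatrix (n : ℕ) (τ β : K) : Matrix (Vertex n) (Fin n) K :=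
  Matrix.of fun v j => if Step v.1 (0, j + 1) then weight n τ β v.1 (0, j + 1) else 0

/-- The incidence matrix of the starting points. -/
def startMatrix (K : Type*) [Field K] (n : ℕ) : Matrix (Fin n) (Vertex n) K :=
  Matrix.of fun i u => if u.1 = (↑i, 0) then 1 else 0

/-- The weighted number of paths from `(x, y)` to `(0, j + 1)` whose last step is not up. -/
noncomputable def pathWeight (n : ℕ) (τ β : K) (j x y : ℕ) : K :=
  if y = j + 1 then (if j + 1 = n then τ else 1) ^ x
  else if y ≤ j then
    pathCoeff (if j + 1 = n then τ else 1)
      ((if j + 1 = n then τ else 1) + (if j + 1 = n then β else 1)) x (j - y)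
  else 0

/-- The matrix of weighted numbers of paths from vertices to the axis. -/
noncomputable def pathMatrix (n : ℕ) (τ β : K) : Matrix (Vertex n) (Fin n) K :=
  Matrix.of fun v j => pathWeight n τ β j v.1.1 v.1.2

/-- A path whose last step is not up meets the axis only at its endpoint, so other axis points carry
no weight. -/
lemma pathWeight_zero_left (n : ℕ) (τ β : K) (j y : ℕ) :
    pathWeight n τ β j 0 y = if y = j + 1 then 1 else 0 := by
  rw [pathWeight, pow_zero, pathCoeff_zero_left, ite_self]

/-- Decomposition by the first step. The weights `τ`, `β` may be written without reference to `j`: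
for `j + 1 < n` the terms they multiply vanish at height `n`. -/
lemma pathWeight_rec (n : ℕ) (τ β : K) {j : ℕ} (x y : ℕ) (hj : j < n) :
    pathWeight n τ β j (x + 1) y
      = (if y = n then τ else 1) * pathWeight n τ β j x y + pathWeight n τ β j (x + 1) (y + 1)
        + (if y + 1 = n then β else 1) * pathWeight n τ β j x (y + 1) := by
  rcases lt_trichotomy y (j + 1) with h | h | h
  · rcases Nat.lt_succ_iff_lt_or_eq.mp h with h | h
    · obtain ⟨k, rfl⟩ : ∃ k, j = y + 1 + k := ⟨j - (y + 1), by omega⟩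
      have e1 : y + 1 + k - y = k + 1 := by omega
      have e2 : y + 1 + k - (y + 1) = k := by omega
      have n1 : ¬ y = y + 1 + k + 1 := by omega
      have n2 : ¬ y + 1 = y + 1 + k + 1 := by omega
      have l1 : y ≤ y + 1 + k := by omega
      have l2 : y + 1 ≤ y + 1 + k := by omega
      have m1 : ¬ y = n := by omega
      have m2 : ¬ y + 1 = n := by omega
      simp only [pathWeight, e1, e2, n1, n2, l1, l2, m1, m2, if_true, if_false, pathCoeff_succ_succ]
      ring
    · subst h
      have n1 : ¬ y = y + 1 := by omega
      have m1 : ¬ y = n := by omega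
      simp only [pathWeight, n1, m1, le_refl, Nat.sub_self, if_true, if_false, pathCoeff_succ_zero]
      ring
  · subst h
    have n1 : ¬ j + 1 + 1 = j + 1 := by omega
    have n2 : ¬ j + 1 + 1 ≤ j := by omega
    simp only [pathWeight, n1, n2, if_true, if_false]
    ring
  · have n1 : ¬ y = j + 1 := by omega
    have n2 : ¬ y ≤ j := by omega
    have n3 : ¬ y + 1 = j + 1 := by omega
    have n4 : ¬ y + 1 ≤ j := by omega
    simp only [pathWeight, n1, n2, n3, n4, if_false]
    ring

lemma sum_step (S : Finset (ℕ × ℕ)) (x y : ℕ) (f : ℕ × ℕ → K) :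
    ∑ u ∈ S, (if Step (x + 1, y) u then f u else 0)
      = (if (x, y) ∈ S then f (x, y) else 0)
        + (if (x + 1, y + 1) ∈ S then f (x + 1, y + 1) else 0)
        + (if (x, y + 1) ∈ S then f (x, y + 1) else 0) := by
  have h : ∀ u : ℕ × ℕ, (if Step (x + 1, y) u then f u else 0)
      = (if u = (x, y) then f u else 0) + (if u = (x + 1, y + 1) then f u else 0)
        + (if u = (x, y + 1) then f u else 0) := by
    rintro ⟨a, b⟩
    simp only [step_iff, Prod.mk.injEq]
    split_ifs <;> first | omega | simp
  simp only [h, Finset.sum_add_distrib, Finset.sum_ite_eq']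

lemma weight_left (n : ℕ) (τ β : K) (x y : ℕ) :
    weight n τ β (x + 1, y) (x, y) = if y = n then τ else 1 := by
  simp only [weight]; split_ifs <;> rfl

lemma weight_up (n : ℕ) (τ β : K) (x y : ℕ) :
    weight n τ β (x, y) (x, y + 1) = 1 := by
  simp only [weight]; split_ifs <;> first | omega | rfl

lemma weight_diag (n : ℕ) (τ β : K) (x y : ℕ) :
    weight n τ β (x + 1, y) (x, y + 1) = if y + 1 = n then β else 1 := by
  simp only [weight]; split_ifs <;> first | omega | rfl

lemma exitMatrix_apply (n : ℕ) (τ β : K) (x y : ℕ)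
    (hv : (x + 1, y) ∈ Finset.Ico 1 n ×ˢ Finset.range (n + 1)) (j : Fin n) :
    exitMatrix n τ β ⟨(x + 1, y), hv⟩ j
      = (if x = 0 ∧ y = j + 1 then if y = n then τ else 1 else 0)
        + (if x = 0 ∧ y = j then if y + 1 = n then β else 1 else 0) := by
  simp only [exitMatrix, Matrix.of_apply, step_iff]
  by_cases h : x = 0 ∧ y = j + 1
  · obtain ⟨rfl, rfl⟩ := h
    have : ¬ ((j : ℕ) + 1 = j) := by omega
    simp only [weight_left]
    simp
  · by_cases h' : x = 0 ∧ y = j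
    · obtain ⟨rfl, rfl⟩ := h'
      simp only [weight_diag]
      simp
    · rw [if_neg (by omega), if_neg h, if_neg h', add_zero]

lemma sub_stepMatrix_mul_pathMatrix (n : ℕ) (τ β : K) :
    (1 - stepMatrix n τ β) * pathMatrix n τ β = exitMatrix n τ β := by
  ext ⟨⟨x, y⟩, hv⟩ j
  obtain ⟨h1, h2, h3⟩ := Vertex.bounds ⟨_, hv⟩
  dsimp only at h1 h2 h3
  obtain ⟨x, rfl⟩ : ∃ x', x = x' + 1 := ⟨x - 1, by omega⟩
  have hj := j.2
  rw [exitMatrix_apply, Matrix.sub_mul, Matrix.one_mul, Matrix.sub_apply, Matrix.mul_apply]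
  have hsum : ∑ u : Vertex n, stepMatrix n τ β ⟨(x + 1, y), hv⟩ u * pathMatrix n τ β u j
      = ∑ u ∈ Finset.Ico 1 n ×ˢ Finset.range (n + 1), (if Step (x + 1, y) u then
        weight n τ β (x + 1, y) u * pathWeight n τ β j u.1 u.2 else 0) := by
    rw [← Finset.sum_coe_sort (Finset.Ico 1 n ×ˢ Finset.range (n + 1))]
    refine Finset.sum_congr rfl fun u _ => ?_
    rw [stepMatrix, pathMatrix, Matrix.of_apply, Matrix.of_apply, ite_mul, zero_mul]
  rw [hsum, sum_step, weight_left, weight_up, weight_diag, pathMatrix, Matrix.of_apply]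
  dsimp only
  rw [pathWeight_rec n τ β x y hj]
  have hmem : ∀ a b : ℕ, (a, b) ∈ Finset.Ico 1 n ×ˢ Finset.range (n + 1) ↔
      1 ≤ a ∧ a < n ∧ b ≤ n := by
    intro a b
    simp only [Finset.mem_product, Finset.mem_Ico, Finset.mem_range]
    omega
  simp only [hmem]
  -- For `x = 0` a left or diagonal step lands on the axis, outside the vertex set; the missing term
  -- is exactly the corresponding exit entry.
  have hL : ∀ (z : ℕ) (c : K), z ≤ n → (if 1 ≤ x ∧ x < n ∧ z ≤ n then
      c * pathWeight n τ β j x z else 0)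
        = c * pathWeight n τ β j x z - if x = 0 ∧ z = j + 1 then c else 0 := by
    intro z c hz
    rcases Nat.eq_zero_or_pos x with rfl | hx
    · rw [pathWeight_zero_left, if_neg (by omega)]
      split_ifs <;> first | omega | simp
    · rw [if_pos (by omega), if_neg (by omega), sub_zero]
  -- Up and diagonal steps from height `n` leave the vertex set; they are harmless since the weights
  -- vanish at height `n + 1`.
  have h0 : ∀ z, pathWeight n τ β j z (n + 1) = 0 := by
    intro z
    rw [pathWeight, if_neg (by omega), if_neg (by omega)]
  rw [hL y _ h3]
  rcases h3.eq_or_lt with rfl | h3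
  · rw [if_neg (by omega : ¬ (1 ≤ x + 1 ∧ x + 1 < y ∧ y + 1 ≤ y)), if_neg (by omega : ¬ (1 ≤ x ∧ x < y ∧ y + 1 ≤ y)),
      if_neg (by omega : ¬ (x = 0 ∧ y = (j : ℕ))), h0, h0]
    ring
  · rw [hL (y + 1) _ h3, if_pos (by omega : 1 ≤ x + 1 ∧ x + 1 < n ∧ y + 1 ≤ n)]
    simp only [Nat.add_right_cancel_iff]
    ring

lemma step_potential {a b : ℕ × ℕ} (h : Step a b) : (a.2 : ℤ) - a.1 < (b.2 : ℤ) - b.1 := by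
  rw [step_iff] at h
  omega

/-- Every step increases `y - x`, so only the identity contributes to the Leibniz expansion. -/
lemma det_one_sub_stepMatrix (n : ℕ) (τ β : K) : (1 - stepMatrix n τ β).det = 1 := by
  rw [← Matrix.det_transpose, Matrix.det_apply', Finset.sum_eq_single 1]
  · simp only [Perm.sign_one, Perm.one_apply, Matrix.transpose_apply]
    rw [Finset.prod_eq_one]
    · simp
    · intro v _
      have : ¬ Step v.1 v.1 := fun h => lt_irrefl _ (step_potential h)
      simp [stepMatrix, this]
  · intro σ _ hσ
    by_contra h
    have h0 : ∀ v : Vertex n, σ v = v ∨ Step v.1 (σ v).1 := by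
      intro v
      by_contra hv
      push Not at hv
      apply h
      rw [Finset.prod_eq_zero (Finset.mem_univ v), mul_zero]
      simp [stepMatrix, hv.2, Ne.symm hv.1]
    have h1 : ∀ v ∈ Finset.univ, (v.1.2 : ℤ) - v.1.1 ≤ ((σ v).1.2 : ℤ) - (σ v).1.1 := by
      intro v _
      rcases h0 v with h | h
      · rw [h]
      · exact (step_potential h).le
    -- A permutation preserves the total of `y - x` and decreases it nowhere, so it preserves it at
    -- each vertex.
    have h2 := (Finset.sum_eq_sum_iff_of_le h1).mp
      (Equiv.sum_comp σ (fun v : Vertex n => (v.1.2 : ℤ) - v.1.1)).symm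
    apply hσ
    ext1 v
    rcases h0 v with h | h
    · exact h
    · exact absurd (h2 v (Finset.mem_univ v)) (step_potential h).ne
  · simp

/-- The signed adjacency matrix of the cone graph. -/
def coneMatrix (n : ℕ) (τ β : K) : Matrix (Vertex n) (Vertex n) K :=
  1 - stepMatrix n τ β + exitMatrix n τ β * startMatrix K n

lemma startMatrix_mul_apply (n : ℕ) (M : Matrix (Vertex n) (Fin n) K) (i j : Fin n) :
    (startMatrix K n * M) i j = if h : (i : ℕ) = 0 then 0 else
      M ⟨(i, 0), mem_vertex (Nat.pos_of_ne_zero h) i.2 (Nat.zero_le _)⟩ j := by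
  rw [Matrix.mul_apply]
  simp only [startMatrix, Matrix.of_apply, ite_mul, one_mul, zero_mul]
  split_ifs with h
  · apply Finset.sum_eq_zero
    intro v _
    have := v.bounds
    rw [if_neg]
    intro hv
    rw [hv] at this
    dsimp only at this
    omega
  · rw [Finset.sum_eq_single (⟨(i, 0), mem_vertex (Nat.pos_of_ne_zero h) i.2 (Nat.zero_le _)⟩ :
      Vertex n)]
    · simp
    · intro v _ hv
      rw [if_neg]
      intro h'
      exact hv (Subtype.ext h')
    · simp

/-- The determinant of the cone matrix is that of the generating function matrix. -/
lemma det_coneMatrix (n : ℕ) (τ β : K) :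
    (coneMatrix n τ β).det = (lastColumnMatrix n gen (genColumn τ (τ + β))).det := by
  have h : coneMatrix n τ β
      = (1 - stepMatrix n τ β) * (1 + pathMatrix n τ β * startMatrix K n) := by
    rw [Matrix.mul_add, Matrix.mul_one, ← Matrix.mul_assoc, sub_stepMatrix_mul_pathMatrix,
      coneMatrix]
  rw [h, Matrix.det_mul, det_one_sub_stepMatrix, one_mul, Matrix.det_one_add_mul_comm]
  congr 1
  ext i j
  rw [Matrix.add_apply, startMatrix_mul_apply, gen_eq_genColumn, lastColumnMatrix, Matrix.of_apply,
    coeffRS_genColumn, coeffRS_genColumn, ← one_add_one_eq_two, Matrix.one_apply]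
  simp only [Fin.ext_iff]
  have hj := j.2
  -- The point `(0, 0)` is not a vertex, so row 0 of `S W` is zero; correspondingly the path series
  -- is divisible by `r`.
  by_cases hi : (i : ℕ) = 0
  · simp [hi, pathCoeff_zero_left]
  · rw [dif_neg hi, pathMatrix, Matrix.of_apply, pathWeight, if_neg (Nat.succ_ne_zero _).symm,
      if_pos (Nat.zero_le _), Nat.sub_zero]
    split_ifs <;> first | omega | rfl

/-- The sign attached to an edge of the cone graph. -/
def edgeSign (v u : ℕ × ℕ) : ℤ := if v = u then 1 else if u.2 = 0 ∧ 1 ≤ v.2 then 1 else -1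

/-- The weight attached to an edge of the cone graph. -/
def edgeWeight (n : ℕ) (τ β : K) (v u : ℕ × ℕ) : K :=
  if v = u then 1 else weight n τ β v (unglue v u)

lemma exitMatrix_mul_startMatrix_apply (n : ℕ) (τ β : K) (v u : Vertex n) :
    (exitMatrix n τ β * startMatrix K n) v u =
      if u.1.2 = 0 ∧ Step v.1 (0, u.1.1 + 1) then weight n τ β v.1 (0, u.1.1 + 1) else 0 := by
  have hu := u.bounds
  rw [Matrix.mul_apply]
  simp only [startMatrix, Matrix.of_apply, mul_ite, mul_one, mul_zero]
  rw [Finset.sum_eq_single ⟨u.1.1, hu.2.1⟩]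
  · simp only [exitMatrix, Matrix.of_apply, Prod.ext_iff, true_and, ite_and]
  · intro j _ hj
    rw [if_neg]
    intro h
    exact hj (Fin.ext (congrArg Prod.fst h).symm)
  · simp

/-- The three summands have disjoint supports: the diagonal, the unglued edges and the glued edges.
-/
lemma coneMatrix_apply (n : ℕ) (τ β : K) (v u : Vertex n) :
    coneMatrix n τ β v u = if u = v ∨ Step v.1 (unglue v.1 u.1) then
      (edgeSign v.1 u.1 : K) * edgeWeight n τ β v.1 u.1 else 0 := by
  have hu := u.bounds
  have hv := v.bounds
  rw [coneMatrix, Matrix.add_apply, Matrix.sub_apply, exitMatrix_mul_startMatrix_apply,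
    Matrix.one_apply, stepMatrix, Matrix.of_apply, edgeSign, edgeWeight]
  simp only [← Subtype.ext_iff]
  by_cases huv : v = u
  · subst huv
    have h1 : ¬ Step v.1 v.1 := fun h => lt_irrefl _ (step_potential h)
    have h2 : ¬ (v.1.2 = 0 ∧ Step v.1 (0, v.1.1 + 1)) := by
      rw [step_iff]; dsimp only; omega
    simp [h1, h2]
  · have huv' : ¬ u = v := fun h => huv h.symm
    simp only [huv, huv', if_false, false_or]
    by_cases h : u.1.2 = 0 ∧ 1 ≤ v.1.2
    · have h1 : ¬ Step v.1 u.1 := by rw [step_iff]; omega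
      simp [unglue, h, h1]
    · have h2 : ¬ (u.1.2 = 0 ∧ Step v.1 (0, u.1.1 + 1)) := by
        rw [step_iff]; dsimp only; omega
      simp only [unglue, h, h2, if_false]
      split_ifs <;> simp

lemma det_coneMatrix_eq_sum (n : ℕ) (τ β : K) :
    (coneMatrix n τ β).det = ∑ σ : Perm (Vertex n) with IsCover n σ,
      (((Perm.sign σ : ℤ) * ∏ v, edgeSign v.1 (σ v).1 : ℤ) : K) *
        ∏ v, edgeWeight n τ β v.1 (σ v).1 := by
  -- After transposing, the factors are the entries at `(v, σ v)`, which follow `σ` in the direction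
  -- of the steps.
  rw [← Matrix.det_transpose, Matrix.det_apply', Finset.sum_filter]
  refine Finset.sum_congr rfl fun σ _ => ?_
  simp only [Matrix.transpose_apply, coneMatrix_apply]
  split_ifs with h
  · rw [Finset.prod_congr rfl (fun v _ => if_pos (h v)), Finset.prod_mul_distrib]
    push_cast
    ring
  · rw [IsCover, not_forall] at h
    obtain ⟨v, hv⟩ := h
    rw [Finset.prod_eq_zero (Finset.mem_univ v) (if_neg hv), mul_zero]

end Determinant

/-! ### The paths traced by a cover -/

section Trace

variable {n : ℕ}

lemma unglue_of_glued {v u : ℕ × ℕ} (h : u.2 = 0 ∧ 1 ≤ v.2) : unglue v u = (0, u.1 + 1) :=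
  if_pos h

lemma unglue_of_not_glued {v u : ℕ × ℕ} (h : ¬ (u.2 = 0 ∧ 1 ≤ v.2)) : unglue v u = u :=
  if_neg h

/-- Glued edges land on the axis and the others off it, so the point reached determines the target
vertex. -/
lemma eq_of_unglue_eq {v v' : ℕ × ℕ} {u u' : Vertex n}
    (h : unglue v u.1 = unglue v' u'.1) : u = u' := by
  have hu := u.bounds
  have hu' := u'.bounds
  apply Subtype.ext
  unfold unglue at h
  split_ifs at h with h1 h2 h2
  · rw [Prod.mk.injEq] at h
    ext <;> omega
  · rw [Prod.ext_iff] at h; dsimp only at h; omega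
  · rw [Prod.ext_iff] at h; dsimp only at h; omega
  · exact h

/-- The next point on the path through `a`, in the plane. -/
def moveTo (σ : Perm (Vertex n)) (a : ℕ × ℕ) : ℕ × ℕ :=
  if h : a ∈ Finset.Ico 1 n ×ˢ Finset.range (n + 1) then unglue a (σ ⟨a, h⟩).1 else a

lemma moveTo_vertex (σ : Perm (Vertex n)) (v : Vertex n) :
    moveTo σ v.1 = unglue v.1 (σ v).1 := dif_pos v.2

/-- The points reached successively from `(i, 0)`. -/
def trace (σ : Perm (Vertex n)) (i k : ℕ) : ℕ × ℕ := (moveTo σ)^[k] (i, 0)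

lemma trace_succ (σ : Perm (Vertex n)) (i k : ℕ) :
    trace σ i (k + 1) = moveTo σ (trace σ i k) := Function.iterate_succ_apply' _ _ _

/-- The abscissas of the starting points of the paths of a cover. -/
def starts (σ : Perm (Vertex n)) : Finset ℕ :=
  (Finset.Ico 1 n).filter fun i => ∃ v : Vertex n, (σ v).1 = (i, 0) ∧ 1 ≤ v.1.2

lemma mem_starts {σ : Perm (Vertex n)} {i : ℕ} :
    i ∈ starts σ ↔ ∃ v : Vertex n, (σ v).1 = (i, 0) ∧ 1 ≤ v.1.2 := by
  rw [starts, Finset.mem_filter, and_iff_right_iff_imp]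
  rintro ⟨v, hv, -⟩
  have := (σ v).bounds
  rw [hv] at this
  exact Finset.mem_Ico.mpr ⟨this.1, this.2.1⟩

lemma starts_bounds {σ : Perm (Vertex n)} {i : ℕ} (h : i ∈ starts σ) : 1 ≤ i ∧ i < n :=
  Finset.mem_Ico.mp (Finset.mem_filter.mp h).1

variable {σ : Perm (Vertex n)} (hσ : IsCover n σ)

include hσ

lemma IsCover.step {v : Vertex n} (hv : σ v ≠ v) : Step v.1 (moveTo σ v.1) := by
  rw [moveTo_vertex]
  exact (hσ v).resolve_left hv

omit hσ in
-- A path cannot stop before the axis: a start is the image of a different vertex by a glued edge,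
-- hence is moved, and by injectivity the image of a moved vertex is moved.
lemma trace_vertex {i : ℕ} (hi : i ∈ starts σ) (k : ℕ) (hk : ∀ l ≤ k, (trace σ i l).1 ≠ 0) :
    ∃ v : Vertex n, v.1 = trace σ i k ∧ σ v ≠ v := by
  induction k with
  | zero =>
    obtain ⟨v, hv, hv2⟩ := mem_starts.mp hi
    refine ⟨σ v, hv, fun h => ?_⟩
    have := σ.injective h
    rw [this] at hv
    rw [hv] at hv2
    exact absurd hv2 (by simp)
  | succ k ih =>
    obtain ⟨v, hv, hvσ⟩ := ih fun l hl => hk l (hl.trans (Nat.le_succ k))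
    refine ⟨σ v, ?_, fun h => hvσ (σ.injective h)⟩
    have h1 := hk (k + 1) le_rfl
    rw [trace_succ, ← hv, moveTo_vertex] at h1 ⊢
    rw [unglue_of_not_glued]
    intro h
    rw [unglue_of_glued h] at h1
    exact h1 rfl

lemma exists_trace_eq_zero {i : ℕ} (hi : i ∈ starts σ) : ∃ k, (trace σ i k).1 = 0 := by
  by_contra! h
  have hpot : ∀ k : ℕ, (k : ℤ) - i ≤ ((trace σ i k).2 : ℤ) - (trace σ i k).1 := by
    intro k
    induction k with
    | zero => simp [trace]
    | succ k ih =>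
      obtain ⟨v, hv, hvσ⟩ := trace_vertex hi k fun l _ => h l
      have := step_potential (hσ.step hvσ)
      rw [hv, ← trace_succ] at this
      push_cast
      omega
  -- The potential `y - x` starts at `-i > -n` and gains at least 1 per step; after `2n` steps it
  -- exceeds `n`, too much for a vertex.
  obtain ⟨v, hv, -⟩ := trace_vertex hi (2 * n) fun l _ => h l
  have h1 := hpot (2 * n)
  have h2 := v.bounds
  have h3 := starts_bounds hi
  rw [hv] at h2
  push_cast at h1
  omega

omit hσ in
/-- The number of steps of the path from `(i, 0)`. -/
noncomputable def traceLen (σ : Perm (Vertex n)) (i : ℕ) : ℕ := sInf {k | (trace σ i k).1 = 0}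

lemma trace_traceLen {i : ℕ} (hi : i ∈ starts σ) : (trace σ i (traceLen σ i)).1 = 0 :=
  Nat.sInf_mem (s := {k | (trace σ i k).1 = 0}) (exists_trace_eq_zero hσ hi)

omit hσ in
lemma trace_ne_zero {i k : ℕ} (hk : k < traceLen σ i) : (trace σ i k).1 ≠ 0 :=
  Nat.notMem_of_lt_sInf (s := {k | (trace σ i k).1 = 0}) hk

omit hσ in
lemma trace_vertex_of_lt {i : ℕ} (hi : i ∈ starts σ) {k : ℕ} (hk : k < traceLen σ i) :
    ∃ v : Vertex n, v.1 = trace σ i k ∧ σ v ≠ v :=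
  trace_vertex hi k fun _ hl => trace_ne_zero (hl.trans_lt hk)

lemma traceLen_pos {i : ℕ} (hi : i ∈ starts σ) : 0 < traceLen σ i := by
  rw [Nat.pos_iff_ne_zero]
  intro h
  have := trace_traceLen hσ hi
  rw [h] at this
  have h1 := starts_bounds hi
  change i = 0 at this
  omega

lemma trace_step {i : ℕ} (hi : i ∈ starts σ) {k : ℕ} (hk : k < traceLen σ i) :
    Step (trace σ i k) (trace σ i (k + 1)) := by
  obtain ⟨v, hv, hvσ⟩ := trace_vertex_of_lt hi hk
  rw [trace_succ, ← hv]
  exact hσ.step hvσ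

lemma trace_end {i : ℕ} (hi : i ∈ starts σ) : ∃ j ∈ starts σ, ∃ v : Vertex n,
    trace σ i (traceLen σ i) = (0, j + 1) ∧ (σ v).1 = (j, 0) ∧ v.1 = trace σ i (traceLen σ i - 1) := by
  have hpos := traceLen_pos hσ hi
  obtain ⟨v, hv, hvσ⟩ := trace_vertex_of_lt hi (Nat.sub_lt hpos one_pos)
  have h0 := trace_traceLen hσ hi
  obtain ⟨m, hm⟩ : ∃ m, traceLen σ i = m + 1 := ⟨traceLen σ i - 1, by omega⟩
  rw [hm, Nat.add_sub_cancel] at hv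
  rw [hm, trace_succ, ← hv, moveTo_vertex] at h0
  by_cases h : (σ v).1.2 = 0 ∧ 1 ≤ v.1.2
  · have he : (σ v).1 = ((σ v).1.1, 0) := Prod.ext rfl h.1
    refine ⟨(σ v).1.1, mem_starts.mpr ⟨v, he, h.2⟩, v, ?_, he, ?_⟩
    · rw [hm, trace_succ, ← hv, moveTo_vertex, unglue_of_glued h]
    · rw [hm, Nat.add_sub_cancel, hv]
  · rw [unglue_of_not_glued h] at h0
    have := (σ v).bounds
    omega

omit hσ in
-- Run both paths backwards from a common point: injectivity of `σ` pulls the coincidence back until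
-- one of them is at its start.
lemma trace_inj {i i' : ℕ} (hi : i ∈ starts σ) (hi' : i' ∈ starts σ) {k k' : ℕ}
    (hk : k ≤ traceLen σ i) (hk' : k' ≤ traceLen σ i') (h : trace σ i k = trace σ i' k') :
    i = i' ∧ k = k' := by
  -- The edge entering a start is glued, so no path passes through a start after its first point.
  have key : ∀ {i i' : ℕ}, i ∈ starts σ → i' ∈ starts σ → ∀ {k : ℕ}, k < traceLen σ i' →
      (i, 0) ≠ trace σ i' (k + 1) := by
    intro i i' hi hi' k hk h
    obtain ⟨v, hv, -⟩ := trace_vertex_of_lt hi' hk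
    obtain ⟨w, hw, hw2⟩ := mem_starts.mp hi
    have hi1 := starts_bounds hi
    rw [trace_succ, ← hv, moveTo_vertex] at h
    by_cases hg : (σ v).1.2 = 0 ∧ 1 ≤ v.1.2
    · rw [unglue_of_glued hg, Prod.mk.injEq] at h
      omega
    · rw [unglue_of_not_glued hg, ← hw] at h
      have := σ.injective (Subtype.ext h)
      rw [← h, hw, ← this] at hg
      exact hg ⟨rfl, hw2⟩
  induction k generalizing k' with
  | zero =>
    cases k' with
    | zero => exact ⟨congrArg Prod.fst h, rfl⟩
    | succ k' => exact absurd h (key hi hi' hk')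
  | succ k ih =>
    cases k' with
    | zero => exact absurd h.symm (key hi' hi hk)
    | succ k' =>
      obtain ⟨v, hv, -⟩ := trace_vertex_of_lt hi hk
      obtain ⟨v', hv', -⟩ := trace_vertex_of_lt hi' hk'
      rw [trace_succ, trace_succ, ← hv, ← hv', moveTo_vertex, moveTo_vertex] at h
      have h1 := σ.injective (eq_of_unglue_eq h)
      rw [h1, hv'] at hv
      have h2 := ih (Nat.le_of_succ_le hk) (Nat.le_of_succ_le hk') hv.symm
      exact ⟨h2.1, by rw [h2.2]⟩

/-- Walking backwards along unglued edges decreases `y - x`, which is bounded below, so a glued edge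
is met; its target is a start. -/
lemma exists_trace_eq {v : Vertex n} (hv : σ v ≠ v) :
    ∃ i ∈ starts σ, ∃ k < traceLen σ i, trace σ i k = v.1 := by
  -- Shifting the potential by `n` makes it positive on vertices, so the case `N = 0` is void.
  have h : ∀ (N : ℕ) (v : Vertex n), σ v ≠ v → (v.1.2 : ℤ) - v.1.1 + n ≤ N →
      ∃ i ∈ starts σ, ∃ k < traceLen σ i, trace σ i k = v.1 := by
    intro N
    induction N with
    | zero =>
      intro v _ h
      have := v.bounds
      push_cast at h
      omega
    | succ N ih =>
      intro v hv hN
      obtain ⟨u, rfl⟩ := σ.surjective v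
      have hu : σ u ≠ u := fun h => hv (congrArg σ h)
      by_cases hg : (σ u).1.2 = 0 ∧ 1 ≤ u.1.2
      · have he : (σ u).1 = ((σ u).1.1, 0) := Prod.ext rfl hg.1
        have hm := mem_starts.mpr ⟨u, he, hg.2⟩
        exact ⟨_, hm, 0, traceLen_pos hσ hm, he.symm⟩
      · have hs := step_potential (hσ.step hu)
        have hmv := moveTo_vertex σ u
        rw [unglue_of_not_glued hg] at hmv
        rw [hmv] at hs
        obtain ⟨i, hi, k, hk, hik⟩ := ih u hu (by push_cast at hN; omega)
        have hk1 : trace σ i (k + 1) = (σ u).1 := by rw [trace_succ, hik, hmv]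
        refine ⟨i, hi, k + 1, lt_of_le_of_ne hk fun h => ?_, hk1⟩
        have h0 := trace_traceLen hσ hi
        rw [← h, hk1] at h0
        have := (σ u).bounds
        omega
  have hb := v.bounds
  exact h (2 * n) v hv (by push_cast; omega)

end Trace

/-! ### Non-crossing and signs -/

lemma Step.snd_le {a b : ℕ × ℕ} (h : Step a b) : a.2 ≤ b.2 := by
  rw [step_iff] at h; omega

/-- Of two disjoint paths to the vertical axis, the one on the left ends below the other one. -/
lemma end_lt_end_of_disjoint (f g : ℕ → ℕ × ℕ) (m m' : ℕ)
    (hf : ∀ k < m, Step (f k) (f (k + 1))) (hg : ∀ k < m', Step (g k) (g (k + 1)))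
    (hg0 : (g m').1 = 0) (hfg : ∀ a ≤ m, ∀ b ≤ m', f a ≠ g b)
    (a b : ℕ) (ha : a ≤ m) (hb : b ≤ m')
    (h : ((f a).2 = (g b).2 ∧ (f a).1 < (g b).1) ∨ ((g b).2 = (f a).2 + 1 ∧ (f a).1 ≤ (g b).1)) :
    (f m).2 < (g m').2 := by
  obtain ⟨N, hN⟩ : ∃ N, (m - a) + (m' - b) ≤ N := ⟨_, le_rfl⟩
  induction N generalizing a b with
  | zero =>
    obtain rfl : a = m := by omega
    obtain rfl : b = m' := by omega
    omega
  | succ N ih =>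
    -- The invariant: `f` is strictly left of `g` in the same row, or one row below and not to its
    -- right. In the first case `g` advances, in the second `f`; disjointness excludes the only ways
    -- to break it.
    rcases h with h | h
    · have hbm : b < m' := by
        rcases hb.eq_or_lt with rfl | hb
        · omega
        · exact hb
      have hs := hg b hbm
      have hne := hfg a ha (b + 1) hbm
      refine ih a (b + 1) ha hbm ?_ (by omega)
      rw [step_iff] at hs
      rw [Ne, Prod.ext_iff] at hne
      omega
    · rcases ha.eq_or_lt with rfl | ha'
      · have hmono : ∀ c, b ≤ c → c ≤ m' → (g b).2 ≤ (g c).2 := by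
          intro c hc
          induction c, hc using Nat.le_induction with
          | base => exact fun _ => le_rfl
          | succ c _ ih' => exact fun h => (ih' (by omega)).trans (hg c (by omega)).snd_le
        have := hmono m' hb le_rfl
        omega
      · have hs := hf a ha'
        have hne := hfg (a + 1) ha' b hb
        refine ih (a + 1) b ha' hb ?_ (by omega)
        rw [step_iff] at hs
        rw [Ne, Prod.ext_iff] at hne
        omega

section Sign

variable {n : ℕ} {σ : Perm (Vertex n)} (hσ : IsCover n σ)

include hσ

/-- The path from `(i, 0)` ends at `(0, i + 1)`. -/
lemma trace_end_eq {i : ℕ} (hi : i ∈ starts σ) : trace σ i (traceLen σ i) = (0, i + 1) := by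
  choose e he v hv using fun i : starts σ => trace_end hσ i.2
  have hmono : StrictMono (fun i : starts σ => (⟨e i, he i⟩ : starts σ)) := by
    intro i i' hii'
    have h := end_lt_end_of_disjoint (trace σ i) (trace σ i') (traceLen σ i) (traceLen σ i')
      (fun k hk => trace_step hσ i.2 hk) (fun k hk => trace_step hσ i'.2 hk)
      (trace_traceLen hσ i'.2)
      (fun a ha b hb h => hii'.ne (Subtype.ext (trace_inj i.2 i'.2 ha hb h).1)) 0 0
      (Nat.zero_le _) (Nat.zero_le _) (Or.inl ⟨rfl, hii'⟩)
    rw [(hv i).1, (hv i').1] at h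
    exact Nat.lt_of_succ_lt_succ h
  -- A strictly increasing self-map of a finite chain is the identity.
  have h1 : (⟨e ⟨i, hi⟩, he ⟨i, hi⟩⟩ : starts σ) = ⟨i, hi⟩ :=
    le_antisymm (hmono.apply_le (x := ⟨i, hi⟩)) (hmono.le_apply (x := ⟨i, hi⟩))
  have h2 : e ⟨i, hi⟩ = i := congrArg Subtype.val h1
  rw [(hv ⟨i, hi⟩).1, h2]

/-- The starting point of a path as a vertex. -/
lemma exists_start_vertex {i : ℕ} (hi : i ∈ starts σ) :
    ∃ v : Vertex n, v.1 = (i, 0) ∧ σ v ≠ v :=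
  trace_vertex_of_lt hi (traceLen_pos hσ hi)

/-- The end `(0, i + 1)` is glued to the start `(i, 0)` of the same path, so one path exhausts its
cycle. -/
lemma mem_trace_of_sameCycle {i : ℕ} (hi : i ∈ starts σ) {v w : Vertex n} (hv : v.1 = (i, 0))
    (h : σ.SameCycle v w) : ∃ k < traceLen σ i, trace σ i k = w.1 := by
  obtain ⟨m, -, hm⟩ := h.exists_pow_eq'
  induction m generalizing w with
  | zero => exact ⟨0, traceLen_pos hσ hi, by rw [← hm]; exact hv.symm⟩
  | succ m ih =>
    rw [pow_succ', Perm.mul_apply] at hm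
    obtain ⟨k, hk, hk'⟩ := ih (w := (σ ^ m) v) ⟨m, by simp⟩ rfl
    set u := (σ ^ m) v
    rw [← hm]
    rcases Nat.lt_or_ge (k + 1) (traceLen σ i) with h1 | h1
    · refine ⟨k + 1, h1, ?_⟩
      have h2 := trace_ne_zero h1
      rw [trace_succ, hk', moveTo_vertex] at h2 ⊢
      rw [unglue_of_not_glued]
      intro hg
      rw [unglue_of_glued hg] at h2
      exact h2 rfl
    · refine ⟨0, traceLen_pos hσ hi, ?_⟩
      have h2 := trace_end_eq hσ hi
      rw [show traceLen σ i = k + 1 by omega, trace_succ, hk', moveTo_vertex] at h2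
      by_cases hg : (σ u).1.2 = 0 ∧ 1 ≤ u.1.2
      · rw [unglue_of_glued hg, Prod.mk.injEq] at h2
        refine Prod.ext ?_ hg.1.symm
        change i = _
        omega
      · rw [unglue_of_not_glued hg] at h2
        have := (σ u).bounds
        rw [h2] at this
        simp at this

/-- Each nontrivial cycle contains exactly one start. -/
lemma card_cycleFactorsFinset_eq : σ.cycleFactorsFinset.card = (starts σ).card := by
  symm
  choose v hv hvσ using fun i : starts σ => exists_start_vertex hσ i.2
  rw [← Finset.card_attach]
  refine Finset.card_bij (fun i _ => σ.cycleOf (v i)) ?_ ?_ ?_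
  · intro i _
    rw [Perm.cycleOf_mem_cycleFactorsFinset_iff, Perm.mem_support]
    exact hvσ i
  · intro i _ i' _ h
    have hs : σ.SameCycle (v i) (v i') := by
      rw [Perm.sameCycle_iff_cycleOf_eq_of_mem_support]
      · exact h
      · exact Perm.mem_support.mpr (hvσ i)
      · exact Perm.mem_support.mpr (hvσ i')
    obtain ⟨k, hk, hk'⟩ := mem_trace_of_sameCycle hσ i.2 (hv i) hs
    rw [hv i'] at hk'
    exact Subtype.ext (trace_inj i.2 i'.2 hk.le (Nat.zero_le _) hk').1
  · intro c hc
    obtain ⟨w, hw⟩ := (Perm.mem_cycleFactorsFinset_iff.mp hc).1.nonempty_support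
    have hwσ : σ w ≠ w := by
      rw [← (Perm.mem_cycleFactorsFinset_iff.mp hc).2 w hw]
      exact Perm.mem_support.mp hw
    obtain ⟨i, hi, k, hk, hik⟩ := exists_trace_eq hσ hwσ
    refine ⟨⟨i, hi⟩, Finset.mem_attach _ _, ?_⟩
    have hs : ∀ k < traceLen σ i, ∀ w : Vertex n, trace σ i k = w.1 →
        σ.SameCycle (v ⟨i, hi⟩) w := by
      intro k
      induction k with
      | zero =>
        intro _ w hw
        rw [show w = v ⟨i, hi⟩ from Subtype.ext (hw.symm.trans (hv ⟨i, hi⟩).symm)]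
      | succ k ih =>
        intro hk w hw
        obtain ⟨u, hu, -⟩ := trace_vertex_of_lt hi (Nat.lt_of_succ_lt hk)
        have h1 := ih (Nat.lt_of_succ_lt hk) u hu.symm
        have h2 := trace_ne_zero hk
        rw [hw] at h2
        rw [trace_succ, ← hu, moveTo_vertex, unglue_of_not_glued] at hw
        · rw [← Subtype.ext hw]
          exact h1.apply_right
        · intro hg
          rw [unglue_of_glued hg] at hw
          rw [← hw] at h2
          exact h2 rfl
    rw [Perm.cycle_is_cycleOf hw hc]
    exact ((hs k hk w hik).cycleOf_eq)

/-- The signs in the expansion of the determinant of the cone matrix cancel. -/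
lemma sign_mul_prod_edgeSign : (Perm.sign σ : ℤ) * ∏ v, edgeSign v.1 (σ v).1 = 1 := by
  have hglue : (starts σ).card
      = (σ.support.filter fun v => (σ v).1.2 = 0 ∧ 1 ≤ v.1.2).card := by
    symm
    refine Finset.card_bij (fun v _ => (σ v).1.1) ?_ ?_ ?_
    · intro v hv
      rw [Finset.mem_filter] at hv
      exact mem_starts.mpr ⟨v, Prod.ext rfl hv.2.1, hv.2.2⟩
    · intro v hv w hw h
      rw [Finset.mem_filter] at hv hw
      exact σ.injective (Subtype.ext (Prod.ext h (hv.2.1.trans hw.2.1.symm)))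
    · intro i hi
      obtain ⟨v, hv, hv2⟩ := mem_starts.mp hi
      refine ⟨v, ?_, by rw [hv]⟩
      rw [Finset.mem_filter, Perm.mem_support]
      refine ⟨fun h => ?_, by rw [hv], hv2⟩
      rw [h] at hv
      rw [hv] at hv2
      exact absurd hv2 (by simp)
  have hprod : ∏ v, edgeSign v.1 (σ v).1
      = (-1) ^ (σ.support.filter fun v => ¬ ((σ v).1.2 = 0 ∧ 1 ≤ v.1.2)).card := by
    rw [← Finset.prod_const, ← Finset.univ_inter (σ.support.filter _), ← Finset.prod_ite_mem]
    refine Finset.prod_congr rfl fun v _ => ?_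
    simp only [edgeSign, Finset.mem_filter, Perm.mem_support, ← Subtype.ext_iff, eq_comm (a := v)]
    split_ifs <;> first | rfl | tauto
  have hsum := Finset.card_filter_add_card_filter_not (s := σ.support)
    (fun v => (σ v).1.2 = 0 ∧ 1 ≤ v.1.2)
  rw [hprod, Perm.sign_of_cycleType, Perm.sum_cycleType, Perm.cycleType_def, Multiset.card_map]
  change (((-1) ^ (σ.support.card + σ.cycleFactorsFinset.card) : ℤˣ) : ℤ) * _ = 1
  rw [card_cycleFactorsFinset_eq hσ, hglue]
  push_cast
  rw [← pow_add]
  -- Cycles, starts and glued edges are equal in number, so together with the unglued edges the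
  -- exponent is twice the size of the support.
  exact Even.neg_one_pow ⟨σ.support.card, by omega⟩

end Sign

/-! ### Configurations of paths and covers -/

namespace IsRestrictedPath

variable {i j : ℕ} {p : List (ℕ × ℕ)} (hp : IsRestrictedPath i j p)

include hp

lemma getElem?_zero : p[0]? = some (i, 0) := by
  rw [← List.head?_eq_getElem?]; exact hp.start

lemma getElem?_last : p[p.length - 1]? = some (0, j) := by
  rw [← List.getLast?_eq_getElem?]; exact hp.finish

lemma step {k : ℕ} {a b : ℕ × ℕ} (ha : p[k]? = some a) (hb : p[k + 1]? = some b) : Step a b := by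
  have h := List.isChain_iff_getElem.mp hp.steps
  obtain ⟨hk, rfl⟩ := List.getElem?_eq_some_iff.mp ha
  obtain ⟨hk', rfl⟩ := List.getElem?_eq_some_iff.mp hb
  exact h k hk'

lemma mono {k l : ℕ} (hkl : k ≤ l) {a b : ℕ × ℕ} (ha : p[k]? = some a) (hb : p[l]? = some b) :
    b.1 ≤ a.1 ∧ a.2 ≤ b.2 := by
  induction l, hkl using Nat.le_induction generalizing b with
  | base =>
    rw [ha, Option.some_inj] at hb
    subst hb
    exact ⟨le_rfl, le_rfl⟩
  | succ l hkl ih =>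
    obtain ⟨hl, -⟩ := List.getElem?_eq_some_iff.mp hb
    have hc := List.getElem?_eq_getElem (Nat.lt_of_succ_lt hl)
    have h1 := ih hc
    have h2 := hp.step hc hb
    rw [step_iff] at h2
    omega

lemma index_unique {k l : ℕ} {a : ℕ × ℕ} (ha : p[k]? = some a) (hb : p[l]? = some a) : k = l := by
  have key : ∀ {k l : ℕ}, p[k]? = some a → p[l]? = some a → ¬ k < l := by
    intro k l ha hb hkl
    obtain ⟨hl, -⟩ := List.getElem?_eq_some_iff.mp hb
    have hc := List.getElem?_eq_getElem (lt_of_le_of_lt hkl hl)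
    have h1 := hp.mono hkl hc hb
    have h2 := hp.step ha hc
    rw [step_iff] at h2
    omega
  exact le_antisymm (not_lt.mp (key hb ha)) (not_lt.mp (key ha hb))

lemma getElem?_succ_of_ne_zero {k : ℕ} {a : ℕ × ℕ} (ha : p[k]? = some a) (h : a.1 ≠ 0) :
    ∃ b, p[k + 1]? = some b := by
  obtain ⟨hk, rfl⟩ := List.getElem?_eq_some_iff.mp ha
  rcases Nat.lt_or_ge (k + 1) p.length with h1 | h1
  · exact ⟨_, List.getElem?_eq_getElem h1⟩
  · have h2 := hp.getElem?_last
    rw [show p.length - 1 = k by omega, ha, Option.some_inj] at h2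
    rw [h2] at h
    exact absurd rfl h

/-- From an axis point only up steps are possible, so continuing past it would make the last step
up. -/
lemma ne_zero_of_getElem?_succ {k : ℕ} {a b : ℕ × ℕ} (ha : p[k]? = some a)
    (hb : p[k + 1]? = some b) : a.1 ≠ 0 := by
  intro h
  obtain ⟨hk, -⟩ := List.getElem?_eq_some_iff.mp hb
  obtain ⟨m, hm⟩ : ∃ m, p.length = m + 2 := ⟨p.length - 2, by omega⟩
  have hc := List.getElem?_eq_getElem (l := p) (i := m) (by omega)
  have hd := List.getElem?_eq_getElem (l := p) (i := m + 1) (by omega)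
  have h1 := hp.mono (by omega : k ≤ m) ha hc
  have h2 := hp.step hc hd
  refine hp.last (p.take m) p[m] p[m + 1] ?_ ?_
  · apply List.ext_getElem?
    intro t
    rw [List.getElem?_append, List.length_take, min_eq_left (by omega), List.getElem?_take]
    split_ifs with ht
    · rfl
    · rcases Nat.eq_or_lt_of_le (not_lt.mp ht) with rfl | ht'
      · simp
      · rcases Nat.eq_or_lt_of_le ht' with rfl | ht''
        · simp
        · rw [List.getElem?_eq_none (by omega), List.getElem?_eq_none]
          simp only [List.length_cons, List.length_nil]
          omega
  · rw [step_iff] at h2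
    rw [IsUp]
    omega

lemma eq_last_of_eq_zero {k : ℕ} {a : ℕ × ℕ} (ha : p[k]? = some a) (h : a.1 = 0) : a = (0, j) := by
  obtain ⟨hk, -⟩ := List.getElem?_eq_some_iff.mp ha
  rcases Nat.lt_or_ge (k + 1) p.length with h1 | h1
  · exact absurd h (hp.ne_zero_of_getElem?_succ ha (List.getElem?_eq_getElem h1))
  · have h2 := hp.getElem?_last
    rw [show p.length - 1 = k by omega, ha, Option.some_inj] at h2
    exact h2

lemma bounds {k : ℕ} {a : ℕ × ℕ} (ha : p[k]? = some a) : a.1 ≤ i ∧ a.2 ≤ j := by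
  obtain ⟨hk, -⟩ := List.getElem?_eq_some_iff.mp ha
  exact ⟨(hp.mono (Nat.zero_le _) hp.getElem?_zero ha).1,
    (hp.mono (by omega : k ≤ p.length - 1) ha hp.getElem?_last).2⟩

end IsRestrictedPath

/-- `b` follows `a` in a path of `P`. -/
def Next (P : Finset (List (ℕ × ℕ))) (a b : ℕ × ℕ) : Prop :=
  ∃ p ∈ P, ∃ k : ℕ, p[k]? = some a ∧ p[k + 1]? = some b

/-! ### The successor relation of a configuration. -/

namespace IsConfig

variable {n : ℕ} {P : Finset (List (ℕ × ℕ))} (hP : IsConfig n P)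

include hP

lemma exists_isRestrictedPath {p : List (ℕ × ℕ)} (hp : p ∈ P) :
    ∃ i j, 1 ≤ i ∧ i < n ∧ 1 ≤ j ∧ j < n ∧ IsRestrictedPath i (j + 1) p := by
  obtain ⟨I, hI, h, -⟩ := hP
  obtain ⟨i, hi, j, hj, h⟩ := h p hp
  have hi' := Finset.mem_Ico.mp (hI hi)
  have hj' := Finset.mem_Ico.mp (hI hj)
  exact ⟨i, j, hi'.1, hi'.2, hj'.1, hj'.2, h⟩

lemma unique {p q : List (ℕ × ℕ)} (hp : p ∈ P) (hq : q ∈ P) {k l : ℕ} {a : ℕ × ℕ}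
    (hk : p[k]? = some a) (hl : q[l]? = some a) : p = q ∧ k = l := by
  have hpq : p = q := by
    obtain ⟨I, -, -, -, -, h⟩ := hP
    by_contra hne
    exact h p hp q hq hne (List.mem_of_getElem? hk) (List.mem_of_getElem? hl)
  subst hpq
  obtain ⟨i, j, -, -, -, -, h⟩ := hP.exists_isRestrictedPath hp
  exact ⟨rfl, h.index_unique hk hl⟩

lemma next_right_unique {a b b' : ℕ × ℕ} (h : Next P a b) (h' : Next P a b') : b = b' := by
  obtain ⟨p, hp, k, hk, hk1⟩ := h
  obtain ⟨q, hq, l, hl, hl1⟩ := h'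
  obtain ⟨rfl, rfl⟩ := hP.unique hp hq hk hl
  rw [hk1, Option.some_inj] at hl1
  exact hl1

lemma next_left_unique {a a' b : ℕ × ℕ} (h : Next P a b) (h' : Next P a' b) : a = a' := by
  obtain ⟨p, hp, k, hk, hk1⟩ := h
  obtain ⟨q, hq, l, hl, hl1⟩ := h'
  obtain ⟨rfl, hkl⟩ := hP.unique hp hq hk1 hl1
  rw [Nat.add_right_cancel_iff] at hkl
  rw [hkl, hl, Option.some_inj] at hk
  exact hk.symm

lemma step_of_next {a b : ℕ × ℕ} (h : Next P a b) : Step a b := by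
  obtain ⟨p, hp, k, hk, hk1⟩ := h
  obtain ⟨i, j, -, -, -, -, h⟩ := hP.exists_isRestrictedPath hp
  exact h.step hk hk1

lemma mem_vertex_of_next {a b : ℕ × ℕ} (h : Next P a b) :
    a ∈ Finset.Ico 1 n ×ˢ Finset.range (n + 1) := by
  obtain ⟨p, hp, k, hk, hk1⟩ := h
  obtain ⟨i, j, hi, hi', hj, hj', h⟩ := hP.exists_isRestrictedPath hp
  have h1 := h.ne_zero_of_getElem?_succ hk hk1
  have h2 := h.bounds hk
  exact mem_vertex (by omega) (by omega) (by omega)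

lemma exists_next_of_ne_zero {a b : ℕ × ℕ} (h : Next P a b) (hb : b.1 ≠ 0) : ∃ c, Next P b c := by
  obtain ⟨p, hp, k, hk, hk1⟩ := h
  obtain ⟨i, j, -, -, -, -, h⟩ := hP.exists_isRestrictedPath hp
  obtain ⟨c, hc⟩ := h.getElem?_succ_of_ne_zero hk1 hb
  exact ⟨c, p, hp, k + 1, hk1, hc⟩

lemma next_of_head {p : List (ℕ × ℕ)} (hp : p ∈ P) {a : ℕ × ℕ} (ha : p[0]? = some a) :
    (∃ b, Next P a b) ∧ ∀ c, ¬ Next P c a := by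
  obtain ⟨i, j, hi, -, -, -, h⟩ := hP.exists_isRestrictedPath hp
  constructor
  · have h1 := h.getElem?_zero
    rw [ha, Option.some_inj] at h1
    obtain ⟨b, hb⟩ := h.getElem?_succ_of_ne_zero ha (by rw [h1]; dsimp only; omega)
    exact ⟨b, p, hp, 0, ha, hb⟩
  · rintro c ⟨q, hq, k, hk, hk1⟩
    exact absurd (hP.unique hp hq ha hk1).2 (Nat.succ_ne_zero k).symm

/-- The equality of the index sets of starts and ends enters here: where a path exits, the glued
vertex starts some path. -/
lemma exists_head_of_next_zero {a b : ℕ × ℕ} (h : Next P a b) (hb : b.1 = 0) :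
    ∃ c, b = (0, c + 1) ∧ 1 ≤ c ∧ c < n ∧ ∃ q ∈ P, q[0]? = some (c, 0) := by
  obtain ⟨p, hp, k, hk, hk1⟩ := h
  obtain ⟨I, hI, h, hs, -, -⟩ := hP
  obtain ⟨i, -, j, hj, h⟩ := h p hp
  have hj' := Finset.mem_Ico.mp (hI hj)
  obtain ⟨q, hq, hq'⟩ := hs j hj
  exact ⟨j, h.eq_last_of_eq_zero hk1 hb, hj'.1, hj'.2, q, hq, by
    rw [← List.head?_eq_getElem?]; exact hq'⟩

end IsConfig

/-- The cover `σ` moves the vertices along the paths of `P`. -/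
def Associated {n : ℕ} (P : Finset (List (ℕ × ℕ))) (σ : Perm (Vertex n)) : Prop :=
  ∀ (v : Vertex n) (b : ℕ × ℕ), Next P v.1 b ↔ σ v ≠ v ∧ unglue v.1 (σ v).1 = b

lemma IsConfig.exists_associated {n : ℕ} {P : Finset (List (ℕ × ℕ))} (hP : IsConfig n P) :
    ∃ σ : Perm (Vertex n), IsCover n σ ∧ Associated P σ := by
  have key : ∀ v : Vertex n, ∃ u : Vertex n, (∀ b, Next P v.1 b → unglue v.1 u.1 = b) ∧
      ((∀ b, ¬ Next P v.1 b) → u = v) := by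
    intro v
    by_cases h : ∃ b, Next P v.1 b
    · obtain ⟨b, hb⟩ := h
      have hs := hP.step_of_next hb
      by_cases hb0 : b.1 = 0
      · obtain ⟨c, rfl, hc1, hc2, -⟩ := hP.exists_head_of_next_zero hb hb0
        refine ⟨⟨(c, 0), mem_vertex hc1 hc2 (Nat.zero_le _)⟩, ?_, fun h => absurd hb (h _)⟩
        intro b hb'
        rw [hP.next_right_unique hb' hb, unglue_of_glued]
        refine ⟨rfl, ?_⟩
        rw [step_iff] at hs
        dsimp only at hs
        omega
      · obtain ⟨c, hc⟩ := hP.exists_next_of_ne_zero hb hb0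
        refine ⟨⟨b, hP.mem_vertex_of_next hc⟩, ?_, fun h => absurd hb (h _)⟩
        intro b' hb'
        rw [hP.next_right_unique hb' hb, unglue_of_not_glued]
        rw [step_iff] at hs
        dsimp only
        omega
    · push Not at h
      exact ⟨v, fun b hb => absurd hb (h b), fun _ => rfl⟩
  choose f hf hf' using key
  have hinj : Function.Injective f := by
    -- The target of a glued edge is the head of a path: it has a successor, hence is not a fixed
    -- vertex, and has no predecessor on a path. Its preimage must therefore be the unique vertex
    -- exiting at that height.
    have case1 : ∀ v v' : Vertex n, ∀ b, Next P v.1 b → f v = f v' →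
        (f v).1.2 = 0 ∧ 1 ≤ v.1.2 → v = v' := by
      intro v v' b hb h hg
      have h1 := hf v b hb
      rw [unglue_of_glued hg] at h1
      obtain ⟨c, hc, -, -, q, hq, hq0⟩ := hP.exists_head_of_next_zero hb (by rw [← h1])
      rw [← h1, Prod.mk.injEq, Nat.add_right_cancel_iff] at hc
      have hc' : (c, 0) = (f v).1 := Prod.ext hc.2.symm hg.1.symm
      rw [hc'] at hq0
      obtain ⟨⟨d, hd⟩, hno⟩ := hP.next_of_head hq hq0
      by_cases h' : ∃ b', Next P v'.1 b'
      · obtain ⟨b', hb'⟩ := h'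
        have h2 := hf v' b' hb'
        rw [← h] at h2
        by_cases hg' : (f v).1.2 = 0 ∧ 1 ≤ v'.1.2
        · rw [unglue_of_glued hg', h1] at h2
          rw [← h2] at hb'
          exact Subtype.ext (hP.next_left_unique hb hb')
        · rw [unglue_of_not_glued hg'] at h2
          rw [← h2] at hb'
          exact absurd hb' (hno _)
      · push Not at h'
        rw [h, hf' v' h'] at hd
        exact absurd hd (h' _)
    intro v v' h
    by_cases hv : ∃ b, Next P v.1 b
    · obtain ⟨b, hb⟩ := hv
      by_cases hg : (f v).1.2 = 0 ∧ 1 ≤ v.1.2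
      · exact case1 v v' b hb h hg
      · have h1 := hf v b hb
        rw [unglue_of_not_glued hg] at h1
        have hu := (f v).bounds
        obtain ⟨d, hd⟩ := hP.exists_next_of_ne_zero hb (by rw [← h1]; omega)
        by_cases hv' : ∃ b', Next P v'.1 b'
        · obtain ⟨b', hb'⟩ := hv'
          by_cases hg' : (f v').1.2 = 0 ∧ 1 ≤ v'.1.2
          · exact (case1 v' v b' hb' h.symm hg').symm
          · have h2 := hf v' b' hb'
            rw [unglue_of_not_glued hg', ← h, h1] at h2
            rw [← h2] at hb'
            exact Subtype.ext (hP.next_left_unique hb hb')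
        · push Not at hv'
          rw [← h1, h, hf' v' hv'] at hd
          exact absurd hd (hv' _)
    · push Not at hv
      by_cases hv' : ∃ b', Next P v'.1 b'
      · obtain ⟨b', hb'⟩ := hv'
        by_cases hg' : (f v').1.2 = 0 ∧ 1 ≤ v'.1.2
        · exact (case1 v' v b' hb' h.symm hg').symm
        · have h1 := hf v' b' hb'
          rw [unglue_of_not_glued hg'] at h1
          have hu := (f v').bounds
          obtain ⟨d, hd⟩ := hP.exists_next_of_ne_zero hb' (by rw [← h1]; omega)
          rw [← h1, ← h, hf' v hv] at hd
          exact absurd hd (hv _)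
      · push Not at hv'
        rw [← hf' v hv, ← hf' v' hv', h]
  refine ⟨Equiv.ofBijective f (Finite.injective_iff_bijective.mp hinj), ?_, ?_⟩
  · intro v
    rw [Equiv.ofBijective_apply]
    by_cases hv : ∃ b, Next P v.1 b
    · obtain ⟨b, hb⟩ := hv
      rw [hf v b hb]
      exact Or.inr (hP.step_of_next hb)
    · push Not at hv
      exact Or.inl (hf' v hv)
  · intro v b
    rw [Equiv.ofBijective_apply]
    constructor
    · intro hb
      have h1 := hf v b hb
      refine ⟨fun h => ?_, h1⟩
      have hs := hP.step_of_next hb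
      rw [h] at h1
      rw [← h1] at hs
      exact not_step_unglue_self _ hs
    · rintro ⟨hne, rfl⟩
      by_cases hv : ∃ b, Next P v.1 b
      · obtain ⟨b, hb⟩ := hv
        rwa [hf v b hb]
      · push Not at hv
        exact absurd (hf' v hv) hne

lemma Associated.right_unique {n : ℕ} {P : Finset (List (ℕ × ℕ))} {σ σ' : Perm (Vertex n)}
    (h : Associated P σ) (h' : Associated P σ') : σ = σ' := by
  ext1 v
  by_cases hv : σ v = v
  · by_contra hne
    have h1 := (h' v _).mpr ⟨fun h2 => hne (hv.trans h2.symm), rfl⟩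
    exact ((h v _).mp h1).1 hv
  · exact (eq_of_unglue_eq ((h' v _).mp ((h v _).mpr ⟨hv, rfl⟩)).2).symm

/-- The cover determines `Next`, and a path is recovered from `Next` and its head, a point with a
successor but no predecessor. No path is a single point, since it starts off the axis. -/
lemma Associated.left_unique {n : ℕ} {P P' : Finset (List (ℕ × ℕ))} {σ : Perm (Vertex n)}
    (hP : IsConfig n P) (hP' : IsConfig n P') (h : Associated P σ) (h' : Associated P' σ) :
    P = P' := by
  have key : ∀ {P P' : Finset (List (ℕ × ℕ))}, IsConfig n P → IsConfig n P' → Associated P σ →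
      Associated P' σ → P ⊆ P' := by
    intro P P' hP hP' h h' p hp
    have hn : ∀ {a b}, Next P a b → Next P' a b := fun {a b} hab =>
      (h' ⟨a, hP.mem_vertex_of_next hab⟩ b).mpr ((h ⟨a, hP.mem_vertex_of_next hab⟩ b).mp hab)
    have hn' : ∀ {a b}, Next P' a b → Next P a b := fun {a b} hab =>
      (h ⟨a, hP'.mem_vertex_of_next hab⟩ b).mpr ((h' ⟨a, hP'.mem_vertex_of_next hab⟩ b).mp hab)
    obtain ⟨i, j, -, -, -, -, hpath⟩ := hP.exists_isRestrictedPath hp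
    have h0 := hpath.getElem?_zero
    obtain ⟨⟨b, hb⟩, hno⟩ := hP.next_of_head hp h0
    obtain ⟨p', hp', k, hk, hk1⟩ := hn hb
    have hk0 : k = 0 := by
      cases k with
      | zero => rfl
      | succ k =>
        obtain ⟨hlt, -⟩ := List.getElem?_eq_some_iff.mp hk
        exact absurd (hn' ⟨p', hp', k, List.getElem?_eq_getElem (Nat.lt_of_succ_lt hlt), hk⟩)
          (hno _)
    subst hk0
    suffices p = p' by rwa [this]
    apply List.ext_getElem?
    intro t
    induction t with
    | zero => rw [h0, hk]
    | succ t ih =>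
      have e1 : ∀ b, p[t + 1]? = some b → p'[t + 1]? = some b := by
        intro b hb
        obtain ⟨hlt, -⟩ := List.getElem?_eq_some_iff.mp hb
        have ha := List.getElem?_eq_getElem (Nat.lt_of_succ_lt hlt)
        obtain ⟨q, hq, l, hl, hl1⟩ := hn ⟨p, hp, t, ha, hb⟩
        obtain ⟨rfl, rfl⟩ := hP'.unique hp' hq (ih ▸ ha) hl
        exact hl1
      have e2 : ∀ b, p'[t + 1]? = some b → p[t + 1]? = some b := by
        intro b hb
        obtain ⟨hlt, -⟩ := List.getElem?_eq_some_iff.mp hb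
        have ha := List.getElem?_eq_getElem (Nat.lt_of_succ_lt hlt)
        obtain ⟨q, hq, l, hl, hl1⟩ := hn' ⟨p', hp', t, ha, hb⟩
        obtain ⟨rfl, rfl⟩ := hP.unique hp hq (ih.trans ha) hl
        exact hl1
      exact Option.ext fun b => ⟨e1 b, e2 b⟩
  exact Finset.Subset.antisymm (key hP hP' h h') (key hP' hP h' h)

/-- The path from `(i, 0)`. -/
noncomputable def tracePath {n : ℕ} (σ : Perm (Vertex n)) (i : ℕ) : List (ℕ × ℕ) :=
  (List.range (traceLen σ i + 1)).map (trace σ i)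

lemma tracePath_getElem? {n : ℕ} (σ : Perm (Vertex n)) (i k : ℕ) (a : ℕ × ℕ) :
    (tracePath σ i)[k]? = some a ↔ k ≤ traceLen σ i ∧ trace σ i k = a := by
  rw [tracePath, List.getElem?_map, Option.map_eq_some_iff]
  constructor
  · rintro ⟨m, hm, rfl⟩
    obtain ⟨h1, rfl⟩ := List.getElem?_eq_some_iff.mp hm
    rw [List.length_range] at h1
    rw [List.getElem_range]
    exact ⟨Nat.lt_succ_iff.mp h1, rfl⟩
  · rintro ⟨hk, rfl⟩
    exact ⟨k, List.getElem?_range (Nat.lt_succ_iff.mpr hk), rfl⟩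

lemma tracePath_length {n : ℕ} (σ : Perm (Vertex n)) (i : ℕ) :
    (tracePath σ i).length = traceLen σ i + 1 := by
  rw [tracePath, List.length_map, List.length_range]

lemma IsCover.isRestrictedPath {n : ℕ} {σ : Perm (Vertex n)} (hσ : IsCover n σ) {i : ℕ}
    (hi : i ∈ starts σ) : IsRestrictedPath i (i + 1) (tracePath σ i) where
  start := by
    rw [List.head?_eq_getElem?, tracePath_getElem?]
    exact ⟨Nat.zero_le _, rfl⟩
  finish := by
    rw [List.getLast?_eq_getElem?, tracePath_length, Nat.add_sub_cancel, tracePath_getElem?]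
    exact ⟨le_rfl, trace_end_eq hσ hi⟩
  steps := by
    rw [List.isChain_iff_getElem]
    intro k hk
    have h1 := (tracePath_getElem? σ i _ _).mp (List.getElem?_eq_getElem hk)
    have h2 := (tracePath_getElem? σ i _ _).mp (List.getElem?_eq_getElem (Nat.lt_of_succ_lt hk))
    rw [← h1.2, ← h2.2]
    exact trace_step hσ hi h1.1
  last := by
    intro q a b h hup
    have hlen := congrArg List.length h
    rw [tracePath_length, List.length_append] at hlen
    simp only [List.length_cons, List.length_nil] at hlen
    have h1 := (tracePath_getElem? σ i q.length a).mp (by rw [h]; simp)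
    have h2 := (tracePath_getElem? σ i (q.length + 1) b).mp (by rw [h]; simp)
    have h3 := trace_traceLen hσ hi
    have h4 := trace_ne_zero (σ := σ) (i := i) (k := q.length) (by omega)
    rw [show traceLen σ i = q.length + 1 by omega, h2.2] at h3
    rw [h1.2] at h4
    exact h4 (hup.1.symm.trans h3)

lemma IsCover.exists_associated {n : ℕ} {σ : Perm (Vertex n)} (hσ : IsCover n σ) :
    ∃ P, IsConfig n P ∧ Associated P σ := by
  refine ⟨(starts σ).image (tracePath σ), ⟨starts σ, Finset.filter_subset _ _, ?_, ?_, ?_, ?_⟩, ?_⟩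
  · intro p hp
    obtain ⟨i, hi, rfl⟩ := Finset.mem_image.mp hp
    exact ⟨i, hi, i, hi, hσ.isRestrictedPath hi⟩
  · intro i hi
    exact ⟨_, Finset.mem_image_of_mem _ hi, (hσ.isRestrictedPath hi).start⟩
  · intro i hi
    exact ⟨_, Finset.mem_image_of_mem _ hi, (hσ.isRestrictedPath hi).finish⟩
  · intro p hp q hq hpq
    obtain ⟨i, hi, rfl⟩ := Finset.mem_image.mp hp
    obtain ⟨j, hj, rfl⟩ := Finset.mem_image.mp hq
    intro a ha hb
    obtain ⟨k, hk⟩ := List.mem_iff_getElem?.mp ha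
    obtain ⟨l, hl⟩ := List.mem_iff_getElem?.mp hb
    rw [tracePath_getElem?] at hk hl
    apply hpq
    rw [(trace_inj hi hj hk.1 hl.1 (hk.2.trans hl.2.symm)).1]
  · intro v b
    constructor
    · rintro ⟨p, hp, k, hk, hk1⟩
      obtain ⟨i, hi, rfl⟩ := Finset.mem_image.mp hp
      rw [tracePath_getElem?] at hk hk1
      obtain ⟨w, hw, hwσ⟩ := trace_vertex_of_lt hi hk1.1
      have hwv : w = v := Subtype.ext (hw.trans hk.2)
      subst hwv
      refine ⟨hwσ, ?_⟩
      rw [← hk1.2, trace_succ, hk.2, moveTo_vertex]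
    · rintro ⟨hv, rfl⟩
      obtain ⟨i, hi, k, hk, hik⟩ := exists_trace_eq hσ hv
      refine ⟨_, Finset.mem_image_of_mem _ hi, k, ?_, ?_⟩
      · exact (tracePath_getElem? _ _ _ _).mpr ⟨hk.le, hik⟩
      · exact (tracePath_getElem? _ _ _ _).mpr ⟨hk, by rw [trace_succ, hik, moveTo_vertex]⟩

/-! ### The statistics -/

instance (a b : ℕ × ℕ) : Decidable (IsDiag a b) := by
  unfold IsDiag; infer_instance

/-- The number of left steps at height `n`. -/
def leftCount (n : ℕ) (σ : Perm (Vertex n)) : ℕ :=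
  (Finset.univ.filter fun v : Vertex n => v.1.2 = n ∧ σ v ≠ v).card

/-- The number of diagonal steps to height `n`. -/
def diagCount (n : ℕ) (σ : Perm (Vertex n)) : ℕ :=
  (Finset.univ.filter fun v : Vertex n =>
    v.1.2 + 1 = n ∧ IsDiag v.1 (unglue v.1 (σ v).1)).card

lemma unglue_snd_le {n : ℕ} (v u : Vertex n) : (unglue v.1 u.1).2 ≤ n := by
  have hu := u.bounds
  unfold unglue
  split_ifs
  · dsimp only; omega
  · exact hu.2.2

/-- A moved vertex at height `n` can only go left, since heights stay at most `n`; so not being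
fixed detects the left steps there. -/
lemma prod_edgeWeight {K : Type*} [Field K] {n : ℕ} {σ : Perm (Vertex n)} (hσ : IsCover n σ)
    (τ β : K) : ∏ v, edgeWeight n τ β v.1 (σ v).1 = τ ^ leftCount n σ * β ^ diagCount n σ := by
  rw [leftCount, diagCount, ← Finset.prod_const, ← Finset.prod_const, Finset.prod_filter,
    Finset.prod_filter, ← Finset.prod_mul_distrib]
  refine Finset.prod_congr rfl fun v _ => ?_
  by_cases hv : σ v = v
  · have h1 : ¬ IsDiag v.1 (unglue v.1 v.1) := fun h => not_step_unglue_self _ (Or.inr (Or.inr h))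
    simp [edgeWeight, hv, h1]
  · have hs := step_iff.mp ((hσ v).resolve_left hv)
    have hne : ¬ v.1 = (σ v).1 := fun h => hv (Subtype.ext h.symm)
    have hle := unglue_snd_le v (σ v)
    simp only [edgeWeight, if_neg hne, weight, ne_eq, hv, not_false_eq_true, and_true]
    split_ifs <;> simp only [IsDiag] at * <;> first | omega | simp

namespace IsConfig

variable {n : ℕ} {P : Finset (List (ℕ × ℕ))} (hP : IsConfig n P)

include hP

/-- Heights on a path are at most that of its endpoint, so only the path ending at `(0, n)` reaches
row `n`. -/
lemma exists_of_next_top {a b : ℕ × ℕ} (h : Next P a b) (hb : n ≤ b.2) :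
    ∃ p ∈ P, p.getLast? = some (0, n) ∧ ∃ k : ℕ, p[k]? = some a ∧ p[k + 1]? = some b := by
  obtain ⟨p, hp, k, hk, hk1⟩ := h
  obtain ⟨i, j, hi, hi', hj, hj', h⟩ := hP.exists_isRestrictedPath hp
  have h1 := h.bounds hk1
  refine ⟨p, hp, ?_, k, hk, hk1⟩
  rw [h.finish, show j + 1 = n by omega]

lemma eq_of_getLast? {p q : List (ℕ × ℕ)} (hp : p ∈ P) (hq : q ∈ P) {a : ℕ × ℕ}
    (h : p.getLast? = some a) (h' : q.getLast? = some a) : p = q := by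
  rw [List.getLast?_eq_getElem?] at h h'
  exact (hP.unique hp hq h h').1

lemma counts_of_forall_ne {σ : Perm (Vertex n)} (hσ : IsCover n σ) (hPσ : Associated P σ)
    (hne : ∀ p ∈ P, p.getLast? ≠ some (0, n)) : leftCount n σ = 0 ∧ diagCount n σ = 0 := by
  have key : ∀ v : Vertex n, σ v ≠ v → ¬ n ≤ (unglue v.1 (σ v).1).2 := by
    intro v hv hn
    obtain ⟨p, hp, hp', -⟩ := hP.exists_of_next_top ((hPσ v _).mpr ⟨hv, rfl⟩) hn
    exact hne p hp hp'
  rw [leftCount, diagCount, Finset.card_eq_zero, Finset.card_eq_zero]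
  constructor
  · refine Finset.filter_eq_empty_iff.mpr fun v _ h => key v h.2 ?_
    have := ((hσ v).resolve_left h.2).snd_le
    omega
  · refine Finset.filter_eq_empty_iff.mpr fun v _ h => key v ?_ ?_
    · intro h1
      rw [h1] at h
      exact not_step_unglue_self _ (Or.inr (Or.inr h.2))
    · have := h.2.2
      omega

lemma counts_of_mem {σ : Perm (Vertex n)} (hσ : IsCover n σ) (hPσ : Associated P σ)
    {p : List (ℕ × ℕ)} (hp : p ∈ P) (hlast : p.getLast? = some (0, n)) :
    ell₂ n p = leftCount n σ ∧ ell₁ n p = leftCount n σ + diagCount n σ ∧ ell₁ n p < n := by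
  obtain ⟨i, j, hi, hi', hj, hj', hpath⟩ := hP.exists_isRestrictedPath hp
  have hjn : j + 1 = n := by
    have := hpath.finish
    rw [hlast, Option.some_inj, Prod.mk.injEq] at this
    exact this.2.symm
  rw [hjn] at hpath
  have hex : ∃ k, ∃ a : ℕ × ℕ, p[k]? = some a ∧ a.2 = n := ⟨_, _, hpath.getElem?_last, rfl⟩
  classical
  -- The first point at height `n` is `a`, with index `m + 1`, and `c` is the point before it: the
  -- two statistics are `a.1` and `c.1`, which differ by 1 exactly for a diagonal step.
  obtain ⟨k, hk, hmin⟩ : ∃ k, (∃ a : ℕ × ℕ, p[k]? = some a ∧ a.2 = n) ∧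
      ∀ l < k, ¬ ∃ a : ℕ × ℕ, p[l]? = some a ∧ a.2 = n :=
    ⟨Nat.find hex, Nat.find_spec hex, fun l hl => Nat.find_min hex hl⟩
  obtain ⟨a, ha, han⟩ := hk
  have hk0 : k ≠ 0 := by
    rintro rfl
    rw [hpath.getElem?_zero, Option.some_inj] at ha
    rw [← ha] at han
    dsimp only at han
    omega
  obtain ⟨m, rfl⟩ : ∃ m, k = m + 1 := ⟨k - 1, by omega⟩
  obtain ⟨hlt, hka⟩ := List.getElem?_eq_some_iff.mp ha
  obtain ⟨c, hc⟩ : ∃ c, p[m]? = some c := ⟨_, List.getElem?_eq_getElem (Nat.lt_of_succ_lt hlt)⟩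
  have hcn : c.2 ≠ n := fun h => hmin m (Nat.lt_succ_self m) ⟨c, hc, h⟩
  have hca := hpath.step hc ha
  have hca' := step_iff.mp hca
  have hfirst : ∀ l x, p[l]? = some x → x.2 = n → m + 1 ≤ l := by
    intro l x hx hxn
    by_contra h
    exact hmin l (not_le.mp h) ⟨x, hx, hxn⟩
  have hrow : ∀ t ≤ a.1, p[m + 1 + t]? = some (a.1 - t, n) := by
    intro t
    induction t with
    | zero =>
      intro _
      rw [Nat.add_zero, ha, ← han, Nat.sub_zero]
    | succ t ih =>
      intro ht
      have h1 := ih (Nat.le_of_succ_le ht)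
      obtain ⟨b, hb⟩ := hpath.getElem?_succ_of_ne_zero h1 (by dsimp only; omega)
      have h2 := step_iff.mp (hpath.step h1 hb)
      have h3 := hpath.bounds hb
      dsimp only at h2
      rw [← Nat.add_assoc, hb, Option.some_inj]
      ext <;> dsimp only <;> omega
  have hnext : ∀ v : Vertex n, σ v ≠ v → n ≤ (unglue v.1 (σ v).1).2 →
      ∃ l : ℕ, p[l]? = some v.1 ∧ p[l + 1]? = some (unglue v.1 (σ v).1) := by
    intro v hv hn
    obtain ⟨q, hq, hq', h⟩ := hP.exists_of_next_top ((hPσ v _).mpr ⟨hv, rfl⟩) hn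
    rwa [hP.eq_of_getLast? hp hq hlast hq']
  -- The left steps at height `n` start at the points `(x, n)` with `1 ≤ x ≤ a.1`.
  have hleft : leftCount n σ = a.1 := by
    rw [leftCount, ← Nat.add_sub_cancel (n := a.1) (m := 1), ← Nat.card_Ico]
    refine Finset.card_bij (fun v _ => v.1.1) ?_ ?_ ?_
    · intro v hv
      rw [Finset.mem_filter] at hv
      obtain ⟨l, hl, -⟩ := hnext v hv.2.2
        (hv.2.1.symm.le.trans ((hσ v).resolve_left hv.2.2).snd_le)
      have h1 := hpath.mono (hfirst l _ hl hv.2.1) ha hl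
      have h2 := v.bounds
      exact Finset.mem_Ico.mpr ⟨h2.1, by omega⟩
    · intro v hv w hw h
      rw [Finset.mem_filter] at hv hw
      exact Subtype.ext (Prod.ext h (hv.2.1.trans hw.2.1.symm))
    · intro x hx
      rw [Finset.mem_Ico] at hx
      have h1 := hrow (a.1 - x) (Nat.sub_le _ _)
      rw [show a.1 - (a.1 - x) = x by omega] at h1
      obtain ⟨b, hb⟩ := hpath.getElem?_succ_of_ne_zero h1 (by dsimp only; omega)
      have h2 : Next P (x, n) b := ⟨p, hp, _, h1, hb⟩
      refine ⟨⟨(x, n), hP.mem_vertex_of_next h2⟩, ?_, rfl⟩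
      rw [Finset.mem_filter]
      exact ⟨Finset.mem_univ _, rfl, ((hPσ _ _).mp h2).1⟩
  have hcnext : Next P c a := ⟨p, hp, m, hc, ha⟩
  have hdiag : diagCount n σ = if IsDiag c a then 1 else 0 := by
    have hmem : ∀ v : Vertex n, v.1.2 + 1 = n ∧ IsDiag v.1 (unglue v.1 (σ v).1) ↔
        v.1 = c ∧ IsDiag c a := by
      intro v
      constructor
      · rintro ⟨hvn, hvd⟩
        have hv : σ v ≠ v := fun h1 => by
          rw [h1] at hvd
          exact not_step_unglue_self _ (Or.inr (Or.inr hvd))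
        obtain ⟨l, hl, hl1⟩ := hnext v hv (by have := hvd.2; omega)
        have h1 := hfirst _ _ hl1 (by have := hvd.2; omega)
        have h2 : l ≤ m := by
          by_contra h2
          have := hpath.mono (not_le.mp h2) ha hl
          omega
        obtain rfl : l = m := by omega
        rw [hl, Option.some_inj] at hc
        rw [hl1, Option.some_inj] at ha
        rw [← hc, ← ha]
        exact ⟨rfl, hvd⟩
      · rintro ⟨rfl, hd⟩
        rw [((hPσ v a).mp hcnext).2]
        exact ⟨hd.2.symm.trans han, hd⟩
    rw [diagCount, Finset.filter_congr (fun v _ => hmem v)]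
    split_ifs with hd
    · rw [Finset.card_eq_one]
      refine ⟨⟨c, hP.mem_vertex_of_next hcnext⟩, ?_⟩
      ext v
      simp [hd, Subtype.ext_iff]
    · simp [hd]
  have hell₂ : ell₂ n p = a.1 := by
    have hfind : p.find? (fun v => v.2 = n) = some a := by
      rw [List.find?_eq_some_iff_getElem]
      refine ⟨by simpa using han, m + 1, hlt, hka, ?_⟩
      intro l hl
      simpa using fun h => hmin l hl ⟨_, List.getElem?_eq_getElem (hl.trans hlt), h⟩
    rw [ell₂, if_pos hlast, hfind]
    rfl
  have hell₁ : ell₁ n p = c.1 := by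
    have hfilter : p.filter (fun v => v.2 < n) = p.take (m + 1) := by
      conv_lhs => rw [← List.take_append_drop (m + 1) p]
      rw [List.filter_append, List.filter_eq_self.mpr, List.filter_eq_nil_iff.mpr, List.append_nil]
      · intro x hx
        obtain ⟨l, hl⟩ := List.mem_iff_getElem?.mp hx
        rw [List.getElem?_drop] at hl
        have := hpath.mono (Nat.le_add_right _ _) ha hl
        simp only [decide_eq_true_eq]
        omega
      · intro x hx
        obtain ⟨l, hl⟩ := List.mem_iff_getElem?.mp hx
        rw [List.getElem?_take] at hl
        split_ifs at hl with hlm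
        have h1 := (hpath.bounds hl).2
        have h2 : x.2 ≠ n := fun h => hmin l hlm ⟨x, hl, h⟩
        simp only [decide_eq_true_eq]
        omega
    rw [ell₁, if_pos hlast, hfilter, List.getLast?_eq_getElem?, List.length_take,
      min_eq_left hlt.le, Nat.add_sub_cancel, List.getElem?_take, if_pos (Nat.lt_succ_self m), hc]
    rfl
  have hci := hpath.bounds hc
  rw [hell₁, hell₂, hleft, hdiag]
  refine ⟨rfl, ?_, by omega⟩
  split_ifs with hd
  · exact hd.1
  · rw [IsDiag] at hd
    omega

lemma sum_ell {σ : Perm (Vertex n)} (hσ : IsCover n σ) (hPσ : Associated P σ) :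
    ∑ p ∈ P, ell₂ n p = leftCount n σ ∧ ∑ p ∈ P, ell₁ n p = leftCount n σ + diagCount n σ := by
  by_cases h : ∃ p ∈ P, p.getLast? = some (0, n)
  · obtain ⟨p, hp, hlast⟩ := h
    have h1 := hP.counts_of_mem hσ hPσ hp hlast
    rw [← h1.2.1, ← h1.1]
    constructor
    · refine Finset.sum_eq_single_of_mem p hp fun q hq hqp => if_neg fun h => hqp ?_
      exact hP.eq_of_getLast? hq hp h hlast
    · refine Finset.sum_eq_single_of_mem p hp fun q hq hqp => if_neg fun h => hqp ?_
      exact hP.eq_of_getLast? hq hp h hlast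
  · push Not at h
    have h1 := hP.counts_of_forall_ne hσ hPσ h
    rw [h1.1, h1.2]
    exact ⟨Finset.sum_eq_zero fun p hp => if_neg (h p hp),
      Finset.sum_eq_zero fun p hp => if_neg (h p hp)⟩

end IsConfig

/-- The count is the abscissa of a point on a path that starts at some `(i, 0)` with `i < n`, or is
zero; so summing over `k < n` loses nothing. -/
lemma leftCount_add_diagCount_lt {n : ℕ} (hn : 1 ≤ n) {σ : Perm (Vertex n)} (hσ : IsCover n σ) :
    leftCount n σ + diagCount n σ < n := by
  obtain ⟨P, hP, hPσ⟩ := hσ.exists_associated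
  by_cases h : ∃ p ∈ P, p.getLast? = some (0, n)
  · obtain ⟨p, hp, hlast⟩ := h
    have h1 := hP.counts_of_mem hσ hPσ hp hlast
    rw [← h1.2.1]
    exact h1.2.2
  · push Not at h
    have h1 := hP.counts_of_forall_ne hσ hPσ h
    rw [h1.1, h1.2]
    exact hn

/-- Configurations and covers are equinumerous, for each property that they share. -/
lemma ncard_config_eq {n : ℕ} (A : Finset (List (ℕ × ℕ)) → Prop) (B : Perm (Vertex n) → Prop)
    [DecidablePred B]
    (hAB : ∀ P σ, IsConfig n P → IsCover n σ → Associated P σ → (A P ↔ B σ)) :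
    {P | IsConfig n P ∧ A P}.ncard
      = (Finset.univ.filter fun σ : Perm (Vertex n) => IsCover n σ ∧ B σ).card := by
  rw [← Set.ncard_coe_finset]
  symm
  choose! f hf hf' using fun (σ : Perm (Vertex n)) (h : IsCover n σ) => h.exists_associated
  refine Set.ncard_congr (fun σ _ => f σ) ?_ ?_ ?_
  · intro σ h
    simp only [Finset.coe_filter, Finset.mem_univ, true_and, Set.mem_ofPred_eq] at h
    exact ⟨hf σ h.1, (hAB _ σ (hf σ h.1) h.1 (hf' σ h.1)).mpr h.2⟩
  · intro σ σ' h h' hσ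
    simp only [Finset.coe_filter, Finset.mem_univ, true_and, Set.mem_ofPred_eq] at h h'
    have h1 := hf' σ h.1
    rw [hσ] at h1
    exact h1.right_unique (hf' σ' h'.1)
  · rintro P ⟨hP, hA⟩
    obtain ⟨σ, hσ, hPσ⟩ := hP.exists_associated
    refine ⟨σ, ?_, (Associated.left_unique hP (hf σ hσ) hPσ (hf' σ hσ)).symm⟩
    simp only [Finset.coe_filter, Finset.mem_univ, true_and, Set.mem_ofPred_eq]
    exact ⟨hσ, (hAB P σ hP hσ hPσ).mp hA⟩

lemma refined₁_eq (n k : ℕ) : refined₁ n k = (Finset.univ.filter fun σ : Perm (Vertex n) =>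
    IsCover n σ ∧ leftCount n σ + diagCount n σ = k).card :=
  ncard_config_eq _ _ fun _ _ hP hσ h => by rw [(hP.sum_ell hσ h).2]

lemma refined₂_eq (n k : ℕ) : refined₂ n k = (Finset.univ.filter fun σ : Perm (Vertex n) =>
    IsCover n σ ∧ leftCount n σ = k).card :=
  ncard_config_eq _ _ fun _ _ hP hσ h => by rw [(hP.sum_ell hσ h).1]

/-- The generating function of covers is the determinant of the generating function matrix. -/
lemma sum_covers {K : Type*} [Field K] (n : ℕ) (τ β : K) :
    ∑ σ : Perm (Vertex n) with IsCover n σ, τ ^ leftCount n σ * β ^ diagCount n σ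
      = (lastColumnMatrix n gen (genColumn τ (τ + β))).det := by
  rw [← det_coneMatrix, det_coneMatrix_eq_sum]
  refine Finset.sum_congr rfl fun σ hσ => ?_
  have h := (Finset.mem_filter.mp hσ).2
  rw [sign_mul_prod_edgeSign h, prod_edgeWeight h, Int.cast_one, one_mul]

lemma sum_range_card_filter {K ι : Type*} [Field K] (S : Finset ι) (f : ι → ℕ) (n : ℕ)
    (hf : ∀ x ∈ S, f x < n) (τ : K) :
    ∑ k ∈ Finset.range n, τ ^ k * ((S.filter fun x => f x = k).card : K) = ∑ x ∈ S, τ ^ f x := by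
  rw [← Finset.sum_fiberwise_of_maps_to (t := Finset.range n) (g := f)
    (fun x hx => Finset.mem_range.mpr (hf x hx))]
  refine Finset.sum_congr rfl fun k _ => ?_
  rw [Finset.sum_congr rfl (fun x hx => by rw [(Finset.mem_filter.mp hx).2]), Finset.sum_const,
    nsmul_eq_mul, mul_comm]

lemma partition₁_eq {K : Type*} [Field K] {n : ℕ} (hn : 1 ≤ n) (τ : K) :
    partition₁ n τ = (lastColumnMatrix n gen (genColumn τ (τ + τ))).det := by
  rw [← sum_covers, partition₁]
  simp only [refined₁_eq, ← Finset.filter_filter]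
  rw [sum_range_card_filter _ _ _ fun σ hσ =>
    leftCount_add_diagCount_lt hn (Finset.mem_filter.mp hσ).2]
  simp only [pow_add]

lemma partition₂_eq {K : Type*} [Field K] {n : ℕ} (hn : 1 ≤ n) (τ : K) :
    partition₂ n τ = (lastColumnMatrix n gen (genColumn τ (τ + 1))).det := by
  rw [← sum_covers, partition₂]
  simp only [refined₂_eq, ← Finset.filter_filter]
  rw [sum_range_card_filter _ _ _ fun σ hσ => lt_of_le_of_lt (Nat.le_add_right _ _)
    (leftCount_add_diagCount_lt hn (Finset.mem_filter.mp hσ).2)]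
  simp only [one_pow, mul_one]

/-! ### Quarter-turn symmetric tilings and covers -/

/-- The black cell of a vertex. -/
def cellB (v : ℕ × ℕ) : ℤ × ℤ := (2 * v.1, 2 * v.2)

/-- The white cell in the quadrant of a vertex. -/
def cellW (v : ℕ × ℕ) : ℤ × ℤ :=
  if v.2 = 0 then (1, 2 * v.1 + 1) else (2 * v.1 + 1, 2 * v.2 - 1)

/-- The lower right neighbour of the black cell of a point. -/
def whiteOf (t : ℕ × ℕ) : ℤ × ℤ := (2 * t.1 + 1, 2 * t.2 - 1)

/-- The representative in the quadrant `x > 0`, `y ≥ 0` of the orbit of a cell. -/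
def rep (c : ℤ × ℤ) : ℤ × ℤ :=
  if 0 < c.1 ∧ 0 ≤ c.2 then c else if c.1 ≤ 0 ∧ 0 < c.2 then (c.2, -c.1)
  else if c.1 < 0 ∧ c.2 ≤ 0 then (-c.1, -c.2) else (-c.2, c.1)

lemma rep_rot (c : ℤ × ℤ) : rep (rot c) = rep c := by
  obtain ⟨x, y⟩ := c
  unfold rep rot
  dsimp only
  split_ifs <;> first | omega | (ext <;> dsimp only <;> omega)

lemma rep_rot_iterate (c : ℤ × ℤ) (k : ℕ) : rep (rot^[k] c) = rep c := by
  induction k with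
  | zero => rfl
  | succ k ih => rw [Function.iterate_succ_apply', rep_rot, ih]

lemma exists_rot_iterate_rep (c : ℤ × ℤ) : ∃ k, rot^[k] (rep c) = c := by
  obtain ⟨x, y⟩ := c
  unfold rep
  dsimp only
  split_ifs
  · exact ⟨0, rfl⟩
  · exact ⟨1, by simp [rot]⟩
  · exact ⟨2, by simp [rot]⟩
  · exact ⟨3, by simp [rot]⟩

lemma exists_rot_iterate_eq_rep (c : ℤ × ℤ) : ∃ k, rot^[k] c = rep c := by
  obtain ⟨x, y⟩ := c
  unfold rep
  dsimp only
  split_ifs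
  · exact ⟨0, rfl⟩
  · exact ⟨3, by simp [rot]⟩
  · exact ⟨2, by simp [rot]⟩
  · exact ⟨1, by simp [rot]⟩

lemma exists_rot_iterate_of_rep_eq {c c' : ℤ × ℤ} (h : rep c = rep c') : ∃ k, rot^[k] c = c' := by
  obtain ⟨k, hk⟩ := exists_rot_iterate_eq_rep c
  obtain ⟨l, hl⟩ := exists_rot_iterate_rep c'
  exact ⟨l + k, by rw [Function.iterate_add_apply, hk, h, hl]⟩

lemma eq_or_of_rep_eq {c c' : ℤ × ℤ} (h : rep c = rep c') :
    (c'.1 = c.1 ∧ c'.2 = c.2) ∨ (c'.1 = -c.2 ∧ c'.2 = c.1) ∨ (c'.1 = -c.1 ∧ c'.2 = -c.2) ∨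
      (c'.1 = c.2 ∧ c'.2 = -c.1) := by
  obtain ⟨x, y⟩ := c
  obtain ⟨x', y'⟩ := c'
  unfold rep at h
  dsimp only at h ⊢
  split_ifs at h <;> rw [Prod.mk.injEq] at h <;> omega

lemma mem_domain_iff {n : ℕ} {c : ℤ × ℤ} : c ∈ domain n ↔
    (c.1 % 2 = 1 ∧ c.2 % 2 = 1 ∧ (-(2 * n : ℤ) < c.1 ∧ c.1 < 2 * n) ∧
      (-(2 * n : ℤ) < c.2 ∧ c.2 < 2 * n) ∧ ¬ ((c.1 = 1 ∨ c.1 = -1) ∧ (c.2 = 1 ∨ c.2 = -1))) ∨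
    (c.1 % 2 = 0 ∧ c.2 % 2 = 0 ∧ (-(2 * n : ℤ) < c.1 ∧ c.1 < 2 * n) ∧
      (-(2 * n : ℤ) < c.2 ∧ c.2 < 2 * n) ∧ ¬ (c.1 = 0 ∧ c.2 = 0)) ∨
    (c.1 % 2 = 0 ∧ c.2 % 2 = 0 ∧
      ((0 < c.1 ∧ c.1 < 2 * n ∧ c.2 = 2 * n) ∨
        (c.1 = -(2 * n) ∧ 0 < c.2 ∧ c.2 < 2 * n) ∨
        (-(2 * n) < c.1 ∧ c.1 < 0 ∧ c.2 = -(2 * n)) ∨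
        (c.1 = 2 * n ∧ -(2 * n) < c.2 ∧ c.2 < 0))) := by
  simp only [domain, Set.mem_ofPred_eq, Int.odd_iff, Int.even_iff, abs_lt,
    abs_eq (zero_le_one (α := ℤ)), ne_eq, Prod.ext_iff]

lemma isDomino_iff {d : (ℤ × ℤ) × (ℤ × ℤ)} : IsDomino d ↔
    d.1.1 % 2 = 0 ∧ d.1.2 % 2 = 0 ∧ (d.2.1 = d.1.1 + 1 ∨ d.2.1 = d.1.1 - 1) ∧
      (d.2.2 = d.1.2 + 1 ∨ d.2.2 = d.1.2 - 1) := by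
  simp only [IsDomino, Int.even_iff, abs_eq (zero_le_one (α := ℤ))]
  omega

lemma rot_mem_domain {n : ℕ} {c : ℤ × ℤ} (h : c ∈ domain n) : rot c ∈ domain n := by
  rw [mem_domain_iff] at h ⊢
  unfold rot
  dsimp only
  rcases h with h | h | ⟨h1, h2, h | h | h | h⟩
  · left; omega
  · right; left; omega
  all_goals
    right; right
    refine ⟨by omega, by omega, ?_⟩
    omega

lemma IsDomino.rot {b w : ℤ × ℤ} (h : IsDomino (b, w)) : IsDomino (rot b, rot w) := by
  rw [isDomino_iff] at h ⊢
  unfold HoleyAztec.rot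
  dsimp only at h ⊢
  omega

lemma rep_mem_domain {n : ℕ} {c : ℤ × ℤ} (h : c ∈ domain n) : rep c ∈ domain n := by
  obtain ⟨k, hk⟩ := exists_rot_iterate_eq_rep c
  rw [← hk]
  clear hk
  induction k with
  | zero => exact h
  | succ k ih => rw [Function.iterate_succ_apply']; exact rot_mem_domain ih

/-- Two distinct neighbours of a black cell in one orbit would be among `(±1, ±1)`, which are
removed from the domain. -/
lemma white_unique {n : ℕ} {b w w' : ℤ × ℤ} (hw : w ∈ domain n) (h : IsDomino (b, w))
    (h' : IsDomino (b, w')) (hr : rep w = rep w') : w = w' := by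
  have h1 := eq_or_of_rep_eq hr
  rw [mem_domain_iff] at hw
  rw [isDomino_iff] at h h'
  dsimp only at h h'
  ext <;> omega

/-- Two distinct black neighbours in one orbit would be among `(±2, 0)`, `(0, ±2)`, and their common
neighbour is one of the removed cells `(±1, ±1)`. -/
lemma black_unique {n : ℕ} {b b' w : ℤ × ℤ} (hw : w ∈ domain n)
    (h : IsDomino (b, w)) (h' : IsDomino (b', w)) (hr : rep b = rep b') : b = b' := by
  have h1 := eq_or_of_rep_eq hr
  rw [mem_domain_iff] at hw
  rw [isDomino_iff] at h h'
  dsimp only at h h'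
  ext <;> omega

/-! ### Orbits of cells as vertices, dominos as edges. -/

section Cells

variable {n : ℕ}

lemma cellB_mem_domain (v : Vertex n) : cellB v.1 ∈ domain n := by
  have := v.bounds
  rw [mem_domain_iff, cellB]
  dsimp only
  omega

lemma rep_cellB (v : Vertex n) : rep (cellB v.1) = cellB v.1 := by
  have := v.bounds
  rw [rep, if_pos]
  unfold cellB
  dsimp only
  omega

lemma cellB_injective {v v' : Vertex n} (h : cellB v.1 = cellB v'.1) : v = v' := by
  unfold cellB at h
  rw [Prod.mk.injEq] at h
  apply Subtype.ext
  ext <;> omega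

lemma cellW_injective {v v' : Vertex n} (h : cellW v.1 = cellW v'.1) : v = v' := by
  have hv := v.bounds
  have hv' := v'.bounds
  unfold cellW at h
  apply Subtype.ext
  split_ifs at h <;> rw [Prod.mk.injEq] at h <;> ext <;> omega

lemma rep_pos {c : ℤ × ℤ} (h : ¬ (c.1 = 0 ∧ c.2 = 0)) : 0 < (rep c).1 ∧ 0 ≤ (rep c).2 := by
  unfold rep
  split_ifs <;> (try dsimp only) <;> omega

lemma exists_rep_eq_cellB {c : ℤ × ℤ} (hc : c ∈ domain n) (h0 : c.1 % 2 = 0) :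
    ∃ v : Vertex n, rep c = cellB v.1 := by
  have h1 := rep_mem_domain hc
  have h2 := rep_pos (c := c) (by rw [mem_domain_iff] at hc; omega)
  have h3 : (rep c).1 % 2 = 0 := by
    rw [mem_domain_iff] at hc
    unfold rep
    split_ifs <;> (try dsimp only) <;> omega
  rw [mem_domain_iff] at h1
  refine ⟨⟨(((rep c).1 / 2).toNat, ((rep c).2 / 2).toNat), mem_vertex ?_ ?_ ?_⟩, ?_⟩
  · dsimp only; omega
  · dsimp only; omega
  · dsimp only; omega
  · unfold cellB
    ext <;> dsimp only <;> omega

lemma exists_rep_eq_cellW {c : ℤ × ℤ} (hc : c ∈ domain n) (h0 : c.1 % 2 = 1) :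
    ∃ v : Vertex n, rep c = cellW v.1 := by
  have h1 := rep_mem_domain hc
  have h2 := rep_pos (c := c) (by omega)
  have h3 : (rep c).1 % 2 = 1 := by
    rw [mem_domain_iff] at hc
    unfold rep
    split_ifs <;> (try dsimp only) <;> omega
  rw [mem_domain_iff] at h1
  by_cases h4 : (rep c).1 = 1
  · refine ⟨⟨(((rep c).2 / 2).toNat, 0), mem_vertex ?_ ?_ ?_⟩, ?_⟩
    · dsimp only; omega
    · dsimp only; omega
    · exact Nat.zero_le _
    · rw [cellW, if_pos rfl]
      ext <;> dsimp only <;> omega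
  · refine ⟨⟨(((rep c).1 / 2).toNat, (((rep c).2 + 1) / 2).toNat), mem_vertex ?_ ?_ ?_⟩, ?_⟩
    · dsimp only; omega
    · dsimp only; omega
    · dsimp only; omega
    · rw [cellW, if_neg (by dsimp only; omega)]
      ext <;> dsimp only <;> omega

/-- The gluing is the rotation: the white cell `(1, 2b + 1)` of `(0, b + 1)` is the quarter-turn
image of the cell `(2b + 1, -1)` of `(b, 0)`. -/
lemma rep_whiteOf (v : ℕ × ℕ) (u : Vertex n) : rep (whiteOf (unglue v u.1)) = cellW u.1 := by
  have hu := u.bounds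
  unfold unglue whiteOf cellW rep
  split_ifs <;> first | omega | (ext <;> dsimp only at * <;> omega)

/-- Fixed, left, up and diagonal correspond to the lower right, lower left, upper right and upper
left neighbours. -/
lemma isDomino_whiteOf {v t : ℕ × ℕ} (h : t = v ∨ Step v t) : IsDomino (cellB v, whiteOf t) := by
  rw [step_iff, Prod.ext_iff] at h
  rw [isDomino_iff]
  unfold cellB whiteOf
  dsimp only
  omega

lemma whiteOf_mem_domain (v : ℕ × ℕ) (u : Vertex n) : whiteOf (unglue v u.1) ∈ domain n := by
  have hu := u.bounds
  rw [mem_domain_iff]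
  unfold unglue whiteOf
  split_ifs <;> (try dsimp only) <;> omega

lemma unglue_eq_or_step {v u : Vertex n} (h : u = v ∨ Step v.1 (unglue v.1 u.1)) :
    unglue v.1 u.1 = v.1 ∨ Step v.1 (unglue v.1 u.1) := by
  rcases h with rfl | h
  · left
    rw [unglue_of_not_glued]
    omega
  · exact Or.inr h

lemma eq_or_step_of_isDomino {v u : Vertex n} {w : ℤ × ℤ}
    (h : IsDomino (cellB v.1, w)) (hr : rep w = cellW u.1) :
    u = v ∨ Step v.1 (unglue v.1 u.1) := by
  have hv := v.bounds
  have hu := u.bounds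
  rw [isDomino_iff] at h
  rw [Subtype.ext_iff, Prod.ext_iff, step_iff]
  unfold cellB at h
  unfold rep cellW at hr
  unfold unglue
  dsimp only at h
  split_ifs at hr <;> rw [Prod.ext_iff] at hr <;> dsimp only at hr <;> split_ifs <;>
    (try dsimp only) <;> omega

/-- The tiling of a cover. -/
noncomputable def tilingOf (n : ℕ) (σ : Perm (Vertex n)) : Finset ((ℤ × ℤ) × (ℤ × ℤ)) :=
  @Finset.filter _ (fun d => IsDomino d ∧ d.1 ∈ domain n ∧ d.2 ∈ domain n ∧
      ∃ v, rep d.1 = cellB v.1 ∧ rep d.2 = cellW (σ v).1) (Classical.decPred _)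
    ((Finset.Icc (-(2 * n : ℤ)) (2 * n) ×ˢ Finset.Icc (-(2 * n : ℤ)) (2 * n)) ×ˢ
      (Finset.Icc (-(2 * n : ℤ)) (2 * n) ×ˢ Finset.Icc (-(2 * n : ℤ)) (2 * n)))

lemma mem_tilingOf {σ : Perm (Vertex n)} {d : (ℤ × ℤ) × (ℤ × ℤ)} : d ∈ tilingOf n σ ↔
    IsDomino d ∧ d.1 ∈ domain n ∧ d.2 ∈ domain n ∧
      ∃ v, rep d.1 = cellB v.1 ∧ rep d.2 = cellW (σ v).1 := by
  rw [tilingOf, @Finset.mem_filter _ _ (Classical.decPred _), and_iff_right_iff_imp]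
  rintro ⟨-, h1, h2, -⟩
  rw [mem_domain_iff] at h1 h2
  simp only [Finset.mem_product, Finset.mem_Icc]
  omega

lemma rot_mem_tilingOf {σ : Perm (Vertex n)} {d : (ℤ × ℤ) × (ℤ × ℤ)} (h : d ∈ tilingOf n σ) :
    (rot d.1, rot d.2) ∈ tilingOf n σ := by
  rw [mem_tilingOf] at h ⊢
  obtain ⟨h1, h2, h3, v, h4, h5⟩ := h
  exact ⟨h1.rot, rot_mem_domain h2, rot_mem_domain h3, v, by rw [rep_rot, h4], by rw [rep_rot, h5]⟩

lemma rot_iterate_mem {T : Finset ((ℤ × ℤ) × (ℤ × ℤ))}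
    (hT : ∀ d ∈ T, (rot d.1, rot d.2) ∈ T) {b w : ℤ × ℤ} (h : (b, w) ∈ T) (k : ℕ) :
    (rot^[k] b, rot^[k] w) ∈ T := by
  induction k with
  | zero => exact h
  | succ k ih =>
    rw [Function.iterate_succ_apply', Function.iterate_succ_apply']
    exact hT _ ih

lemma cellB_whiteOf_mem_tilingOf {σ : Perm (Vertex n)} (hσ : IsCover n σ) (v : Vertex n) :
    (cellB v.1, whiteOf (unglue v.1 (σ v).1)) ∈ tilingOf n σ :=
  mem_tilingOf.mpr ⟨isDomino_whiteOf (unglue_eq_or_step (hσ v)), cellB_mem_domain v,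
    whiteOf_mem_domain _ _, v, rep_cellB v, rep_whiteOf _ _⟩

lemma white_unique_tilingOf {σ : Perm (Vertex n)} {b w w' : ℤ × ℤ}
    (h : (b, w) ∈ tilingOf n σ) (h' : (b, w') ∈ tilingOf n σ) : w = w' := by
  rw [mem_tilingOf] at h h'
  obtain ⟨h1, h2, h3, v, h4, h5⟩ := h
  obtain ⟨h1', h2', h3', v', h4', h5'⟩ := h'
  refine white_unique h3 h1 h1' ?_
  rw [h5, h5', cellB_injective (h4.symm.trans h4')]

lemma black_unique_tilingOf {σ : Perm (Vertex n)} {b b' w : ℤ × ℤ}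
    (h : (b, w) ∈ tilingOf n σ) (h' : (b', w) ∈ tilingOf n σ) : b = b' := by
  rw [mem_tilingOf] at h h'
  obtain ⟨h1, h2, h3, v, h4, h5⟩ := h
  obtain ⟨h1', h2', h3', v', h4', h5'⟩ := h'
  refine black_unique h3 h1 h1' ?_
  rw [h4, h4', σ.injective (cellW_injective (h5.symm.trans h5'))]

lemma IsDomino.parity {b w : ℤ × ℤ} (h : IsDomino (b, w)) : b.1 % 2 = 0 ∧ w.1 % 2 = 1 := by
  rw [isDomino_iff] at h
  dsimp only at h
  omega

lemma isSymmetricTiling_tilingOf {σ : Perm (Vertex n)} (hσ : IsCover n σ) :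
    IsSymmetricTiling n (tilingOf n σ) where
  domino := fun d hd => by
    obtain ⟨h1, h2, h3, -⟩ := mem_tilingOf.mp hd
    exact ⟨h1, h2, h3⟩
  symm := fun d hd => rot_mem_tilingOf hd
  cover := by
    intro c hc
    have hpar : c.1 % 2 = 0 ∨ c.1 % 2 = 1 := Int.emod_two_eq_zero_or_one _
    rcases hpar with hpar | hpar
    · obtain ⟨v, hv⟩ := exists_rep_eq_cellB hc hpar
      obtain ⟨k, hk⟩ := exists_rot_iterate_rep c
      have hm := rot_iterate_mem (fun d => rot_mem_tilingOf) (cellB_whiteOf_mem_tilingOf hσ v) k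
      rw [← hv, hk] at hm
      refine ⟨_, ⟨hm, Or.inl rfl⟩, ?_⟩
      rintro ⟨b, w⟩ ⟨hd, hbc | hwc⟩
      · dsimp only at hbc
        subst hbc
        rw [white_unique_tilingOf hd hm]
      · have := (mem_tilingOf.mp hd).1.parity
        dsimp only at hwc
        rw [hwc] at this
        omega
    · obtain ⟨u, hu⟩ := exists_rep_eq_cellW hc hpar
      obtain ⟨v, rfl⟩ := σ.surjective u
      rw [← rep_whiteOf v.1] at hu
      obtain ⟨k, hk⟩ := exists_rot_iterate_of_rep_eq hu.symm
      have hm := rot_iterate_mem (fun d => rot_mem_tilingOf) (cellB_whiteOf_mem_tilingOf hσ v) k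
      rw [hk] at hm
      refine ⟨_, ⟨hm, Or.inr rfl⟩, ?_⟩
      rintro ⟨b, w⟩ ⟨hd, hbc | hwc⟩
      · have := (mem_tilingOf.mp hd).1.parity
        dsimp only at hbc
        rw [hbc] at this
        omega
      · dsimp only at hwc
        subst hwc
        rw [black_unique_tilingOf hd hm]

lemma tilingOf_injective {σ σ' : Perm (Vertex n)} (hσ : IsCover n σ)
    (h : tilingOf n σ = tilingOf n σ') : σ = σ' := by
  ext1 v
  have h1 := cellB_whiteOf_mem_tilingOf hσ v
  rw [h, mem_tilingOf] at h1
  obtain ⟨-, -, -, v', h4, h5⟩ := h1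
  dsimp only at h4 h5
  rw [rep_cellB] at h4
  rw [rep_whiteOf, ← cellB_injective h4] at h5
  exact cellW_injective h5

/-- Send a vertex to the orbit of the white partner of its black cell. By symmetry of the tiling,
equal white orbits force equal black orbits, so the map is a permutation. -/
lemma exists_tilingOf_eq {T : Finset ((ℤ × ℤ) × (ℤ × ℤ))} (hT : IsSymmetricTiling n T) :
    ∃ σ : Perm (Vertex n), IsCover n σ ∧ tilingOf n σ = T := by
  have hblack : ∀ c ∈ domain n, c.1 % 2 = 0 → ∃ w, (c, w) ∈ T := by
    intro c hc hpar
    obtain ⟨⟨b, w⟩, ⟨hd, hbc | hwc⟩, -⟩ := hT.cover c hc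
    · exact ⟨w, by rw [← hbc]; exact hd⟩
    · have := (hT.domino _ hd).1.parity
      dsimp only at hwc
      rw [hwc] at this
      omega
  have hright : ∀ b w w', (b, w) ∈ T → (b, w') ∈ T → w = w' := by
    intro b w w' h h'
    have := (hT.cover b (hT.domino _ h).2.1).unique ⟨h, Or.inl rfl⟩ ⟨h', Or.inl rfl⟩
    exact congrArg Prod.snd this
  have hleft : ∀ b b' w, (b, w) ∈ T → (b', w) ∈ T → b = b' := by
    intro b b' w h h'
    have := (hT.cover w (hT.domino _ h).2.2).unique ⟨h, Or.inr rfl⟩ ⟨h', Or.inr rfl⟩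
    exact congrArg Prod.fst this
  choose w hw using fun v : Vertex n => hblack (cellB v.1) (cellB_mem_domain v) (by simp [cellB])
  have hdom := fun v => hT.domino _ (hw v)
  choose f hf using fun v : Vertex n =>
    exists_rep_eq_cellW (hdom v).2.2 (hdom v).1.parity.2
  have hinj : Function.Injective f := by
    intro v v' h
    have h1 : rep (w v) = rep (w v') := by
      have h2 := hf v
      have h3 := hf v'
      dsimp only at h2 h3
      rw [h2, h3, h]
    obtain ⟨k, hk⟩ := exists_rot_iterate_of_rep_eq h1
    have h2 := rot_iterate_mem hT.symm (hw v) k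
    rw [hk] at h2
    have h3 := congrArg rep (hleft _ _ _ h2 (hw v'))
    rw [rep_rot_iterate, rep_cellB, rep_cellB] at h3
    exact cellB_injective h3
  have hcover : IsCover n (Equiv.ofBijective f (Finite.injective_iff_bijective.mp hinj)) :=
    fun v => eq_or_step_of_isDomino (hdom v).1 (hf v)
  refine ⟨_, hcover, ?_⟩
  have hsub : T ⊆ tilingOf n (Equiv.ofBijective f (Finite.injective_iff_bijective.mp hinj)) := by
    rintro ⟨b, x⟩ hd
    have h1 := hT.domino _ hd
    obtain ⟨v, hv⟩ := exists_rep_eq_cellB h1.2.1 h1.1.parity.1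
    rw [mem_tilingOf]
    refine ⟨h1.1, h1.2.1, h1.2.2, v, hv, ?_⟩
    obtain ⟨k, hk⟩ := exists_rot_iterate_eq_rep b
    have h2 := rot_iterate_mem hT.symm hd k
    dsimp only at hv
    rw [hk, hv] at h2
    have h3 := congrArg rep (hright _ _ _ h2 (hw v))
    rw [rep_rot_iterate] at h3
    exact h3.trans (hf v)
  -- One inclusion suffices: `T` covers every black cell, and `tilingOf` gives each at most one
  -- partner.
  refine Finset.Subset.antisymm ?_ hsub
  rintro ⟨b, x⟩ hd
  have h1 := mem_tilingOf.mp hd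
  obtain ⟨y, hy⟩ := hblack b h1.2.1 h1.1.parity.1
  rwa [white_unique_tilingOf hd (hsub hy)]

/-- The statistics only see dominos with black cell in the quadrant, one per orbit, so they can be
counted vertex by vertex. -/
lemma mem_tilingOf_iff_of_quadrant {σ : Perm (Vertex n)} (hσ : IsCover n σ)
    {d : (ℤ × ℤ) × (ℤ × ℤ)} (h : 0 < d.1.1 ∧ 0 ≤ d.1.2) : d ∈ tilingOf n σ ↔
      ∃ v : Vertex n, d = (cellB v.1, whiteOf (unglue v.1 (σ v).1)) := by
  constructor
  · intro hd
    obtain ⟨-, -, -, v, hv, -⟩ := mem_tilingOf.mp hd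
    rw [rep, if_pos h] at hv
    refine ⟨v, Prod.ext hv ?_⟩
    refine white_unique_tilingOf (b := d.1) hd ?_
    rw [hv]
    exact cellB_whiteOf_mem_tilingOf hσ v
  · rintro ⟨v, rfl⟩
    exact cellB_whiteOf_mem_tilingOf hσ v

lemma card_topUpRight {σ : Perm (Vertex n)} (hσ : IsCover n σ) :
    (topUpRight n (tilingOf n σ)).card = leftCount n σ := by
  symm
  refine Finset.card_bij (fun v _ => (cellB v.1, whiteOf (unglue v.1 (σ v).1))) ?_ ?_ ?_
  · intro v hv
    obtain ⟨-, h1, h2⟩ := Finset.mem_filter.mp hv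
    rw [topUpRight, Finset.mem_filter]
    refine ⟨cellB_whiteOf_mem_tilingOf hσ v, ?_⟩
    have h3 := step_iff.mp ((hσ v).resolve_left h2)
    have h4 := unglue_snd_le v (σ v)
    rw [Prod.ext_iff]
    simp only [cellB, whiteOf]
    omega
  · intro v _ v' _ h
    exact cellB_injective (congrArg Prod.fst h)
  · intro d hd
    obtain ⟨h1, h2, h3⟩ := Finset.mem_filter.mp hd
    have h4 := (mem_tilingOf.mp h1).2.1
    rw [mem_domain_iff] at h4
    obtain ⟨v, rfl⟩ := (mem_tilingOf_iff_of_quadrant hσ (by omega)).mp h1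
    refine ⟨v, Finset.mem_filter.mpr ⟨Finset.mem_univ _, ?_, ?_⟩, rfl⟩
    · simp only [cellB] at h2
      omega
    · intro h5
      rw [Prod.ext_iff, h5, unglue_of_not_glued (by omega)] at h3
      simp only [cellB, whiteOf] at h3
      omega

lemma card_topDiag {σ : Perm (Vertex n)} (hσ : IsCover n σ) :
    (topDiag n (tilingOf n σ)).card = diagCount n σ := by
  symm
  refine Finset.card_bij (fun v _ => (cellB v.1, whiteOf (unglue v.1 (σ v).1))) ?_ ?_ ?_
  · intro v hv
    obtain ⟨-, h1, h2⟩ := Finset.mem_filter.mp hv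
    rw [topDiag, Finset.mem_filter]
    refine ⟨cellB_whiteOf_mem_tilingOf hσ v, ?_⟩
    rw [IsDiag] at h2
    rw [Prod.ext_iff]
    simp only [cellB, whiteOf]
    omega
  · intro v _ v' _ h
    exact cellB_injective (congrArg Prod.fst h)
  · intro d hd
    obtain ⟨h1, h2, h3, h4⟩ := Finset.mem_filter.mp hd
    have h5 := (mem_tilingOf.mp h1).2.1
    rw [mem_domain_iff] at h5
    rw [Prod.ext_iff] at h4
    obtain ⟨v, rfl⟩ := (mem_tilingOf_iff_of_quadrant hσ (by dsimp only at h4; omega)).mp h1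
    refine ⟨v, Finset.mem_filter.mpr ⟨Finset.mem_univ _, ?_⟩, rfl⟩
    simp only [cellB, whiteOf] at h2 h4
    rw [IsDiag]
    omega

end Cells

/-- Symmetric tilings and covers are equinumerous, for each property that they share. -/
lemma ncard_tiling_eq {n : ℕ} (A : Finset ((ℤ × ℤ) × (ℤ × ℤ)) → Prop) (B : Perm (Vertex n) → Prop)
    [DecidablePred B] (hAB : ∀ σ, IsCover n σ → (A (tilingOf n σ) ↔ B σ)) :
    {T | IsSymmetricTiling n T ∧ A T}.ncard
      = (Finset.univ.filter fun σ : Perm (Vertex n) => IsCover n σ ∧ B σ).card := by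
  rw [← Set.ncard_coe_finset]
  symm
  refine Set.ncard_congr (fun σ _ => tilingOf n σ) ?_ ?_ ?_
  · intro σ h
    simp only [Finset.coe_filter, Finset.mem_univ, true_and, Set.mem_ofPred_eq] at h
    exact ⟨isSymmetricTiling_tilingOf h.1, (hAB σ h.1).mpr h.2⟩
  · intro σ σ' h h' hσ
    simp only [Finset.coe_filter, Finset.mem_univ, true_and, Set.mem_ofPred_eq] at h
    exact tilingOf_injective h.1 hσ
  · rintro T ⟨hT, hA⟩
    obtain ⟨σ, hσ, rfl⟩ := exists_tilingOf_eq hT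
    refine ⟨σ, ?_, rfl⟩
    simp only [Finset.coe_filter, Finset.mem_univ, true_and, Set.mem_ofPred_eq]
    exact ⟨hσ, (hAB σ hσ).mp hA⟩

lemma tilingRefined₁_eq (n k : ℕ) : tilingRefined₁ n k = refined₁ n k := by
  rw [refined₁_eq]
  exact ncard_tiling_eq _ _ fun σ hσ => by rw [card_topUpRight hσ, card_topDiag hσ]

lemma tilingRefined₂_eq (n k : ℕ) : tilingRefined₂ n k = refined₂ n k := by
  rw [refined₂_eq]
  exact ncard_tiling_eq _ _ fun σ hσ => by rw [card_topUpRight hσ]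

/-! ### The compact form of the two matrices. -/

section

variable {K : Type*} [Field K]

lemma truncMatrix_genCompact₁ {n : ℕ} (hn : 1 ≤ n) (τ : K) :
    truncMatrix n (genCompact₁ n τ) = lastColumnMatrix n gen (genLast₁ τ) := by
  rw [genLast₁_eq_genColumn, ← truncMatrix_gen_add n hn, genCompact₁, ← two_mul, const_mul,
    const_two]

lemma truncMatrix_genCompact₂ {n : ℕ} (hn : 1 ≤ n) (τ : K) :
    truncMatrix n (genCompact₂ n τ) = lastColumnMatrix n gen (genLast₂ τ) := by
  rw [genLast₂_eq_genColumn, ← truncMatrix_gen_add n hn, genCompact₂, const_add, const_one,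
    add_comm 1]

end

end HoleyAztec

theorem mainTheorem6 (n : ℕ) (hn : 1 ≤ n) :
    (∀ k : ℕ, HoleyAztec.tilingRefined₁ n k = HoleyAztec.refined₁ n k ∧
      HoleyAztec.tilingRefined₂ n k = HoleyAztec.refined₂ n k) ∧
    ∀ {K : Type*} [Field K] (τ : K),
      (HoleyAztec.partition₁ n τ =
          (HoleyAztec.lastColumnMatrix n HoleyAztec.gen (HoleyAztec.genLast₁ τ)).det ∧
        HoleyAztec.partition₁ n τ =
          (HoleyAztec.truncMatrix n (HoleyAztec.genCompact₁ n τ)).det) ∧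
      (HoleyAztec.partition₂ n τ =
          (HoleyAztec.lastColumnMatrix n HoleyAztec.gen (HoleyAztec.genLast₂ τ)).det ∧
        HoleyAztec.partition₂ n τ =
          (HoleyAztec.truncMatrix n (HoleyAztec.genCompact₂ n τ)).det) := by
  refine ⟨fun k => ⟨HoleyAztec.tilingRefined₁_eq n k, HoleyAztec.tilingRefined₂_eq n k⟩, ?_⟩
  intro K _ τ
  rw [HoleyAztec.truncMatrix_genCompact₁ hn, HoleyAztec.truncMatrix_genCompact₂ hn,
    HoleyAztec.partition₁_eq hn, HoleyAztec.partition₂_eq hn, HoleyAztec.genLast₁_eq_genColumn,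
    HoleyAztec.genLast₂_eq_genColumn]
  exact ⟨⟨rfl, rfl⟩, rfl, rfl⟩
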